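/- **Setting.** For $f:\mathbb Z\to\mathbb R$ put $\Delta f(j)=f(j+1)-f(j)$, $\Delta^k=\Delta(\Delta^{k-1})$, $\Delta^0 f=f$, and $f^{[k]}(j)=f(j)f(j+1)\cdots f(j+k-1)$, $f^{[0]}=1$. Let $X$ be an integer-valued random variable with finite mean $\mu$, probability mass function $p$ and support $S=\{j:p(j)>0\}$, and let $q(j)=\delta j^2+\beta j+\gamma$ be a real polynomial of degree at most two with $$\sum_{k\le j}(\mu-k)p(k)=q(j)p(j)\qquad\text{for all }j\in\mathbb Z ,$$ that is, $X\sim\mathrm{CO}(\mu;q)$. Put $M=|S|-1\in\{0,1,\dots\}\cup\{\infty\}$. Let $\mathcal C$ be the class of those $X$ that satisfy $X\sim\mathrm{CO}(\mu;\delta,\beta,\gamma)$ for some $(\mu;\delta,\beta,\gamma)$ and for which $\delta\le 0$ or $S$ is finite. For a probability mass function $p$ (of a random variable $X$) and a quadratic $q$ with leading coefficient $\delta$ let, for $j\in S$, $$P_k(j)=\frac{(-1)^k\Delta^k\big[q^{[k]}(j-k)p(j-k)\big]}{p(j)},\qquad c_k(\delta)=\prod_{j=k-1}^{2k-2}(1-j\delta),\qquad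 \phi_k=\frac{P_k}{\big(k!\,c_k(\delta)\,\mathbb E q^{[k]}(X)\big)^{1/2}} .$$ For $i\ge 0$ let $X_i$ have probability mass function $p_i(j)=q^{[i]}(j)p(j)/\mathbb E q^{[i]}(X)$, put $\delta_i=\delta/(1-2i\delta)$, $q_i(j)=q(j+i)/(1-2i\delta)$, and let $\phi_{k,i}$ be the polynomial $\phi_k$ formed with $(p_i,q_i,\delta_i)$ in place of $(p,q,\delta)$ (when $k=0$, $\phi_{0,i}=1$, whatever $q_i$ is). Finally, for $0\le i\le k$ let $$v^{(i)}_{k-i}=\bigg(\frac{k!\prod_{j=k-1}^{k+i-2}(1-j\delta)}{(k-i)!\;\mathbb E q^{[i]}(X)}\bigg)^{1/2}.$$ **Theorem.** Let $X\sim\mathrm{CO}(\mu;q)$ and let $g$ be a real function on $\mathbb Z$ (only its values on $S$ matter). (a) Let $k$ be an integer with $1\le k\le M$ and $\mathbb E|X|^{2k+1}<\infty$. Then $p_0,\dots,p_k$ are probability mass functions. If moreover $0\le m\le k$ and $\Delta^m g\in L^2(X_m)$ (for instance $m=k$), then $\phi_k(X)g(X)$ is integrable and, for all $i=0,1,\dots,m$,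 $\phi_{k-i,i}(X_i)\Delta^i g(X_i)$ is integrable and $$\mathbb E\,\phi_{k-i,i}(X_i)\,\Delta^i g(X_i)=v^{(i)}_{k-i}\;\mathbb E\,\phi_k(X)g(X).$$ (b) Let $X\in\mathcal C$ and let $n$ be an integer with $1\le n\le M$ and $\Delta^n g\in L^2(X_n)$. Then the Fourier coefficients $\alpha_k=\mathbb E\,\phi_k(X)g(X)$ exist for all integers $0\le k\le M$, and for all $i=0,1,\dots,n$ the expectation below is finite, the series (over integers $k$ with $i\le k\le M$) converges, and $$\mathbb E\,q^{[i]}(X)\big(\Delta^i g(X)\big)^2=\sum_{k=i}^{M}\frac{k!\prod_{j=k-1}^{k+i-2}(1-j\delta)}{(k-i)!}\,\alpha_k^2 .$$ -/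

import Mathlib

open MeasureTheory

noncomputable section

namespace CumOrd

/-- The quadratic `q(j) = δ j² + β j + γ` (any of the coefficients may vanish) on the integers. -/
def quad (δ β γ : ℝ) (j : ℤ) : ℝ := δ * (j : ℝ) ^ 2 + β * (j : ℝ) + γ

/-- The ascending power `f^{[k]}(x) = f(x) f(x+1) ⋯ f(x+k-1)`, with `f^{[0]} = 1`. -/
def ascPow (f : ℤ → ℝ) (k : ℕ) (x : ℤ) : ℝ := ∏ r ∈ Finset.range k, f (x + (r : ℤ))

/-- The `k`-th iterate of the forward difference operator `Δ f(j) = f(j+1) - f(j)`. -/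
def diff (k : ℕ) (f : ℤ → ℝ) : ℤ → ℝ := (fwdDiff (1 : ℤ))^[k] f

/-- The probability mass function `p(j) = Pr(X = j)` of an integer-valued random variable. -/
def pmfOf {Ω : Type*} [MeasurableSpace Ω] (P : Measure Ω) (X : Ω → ℤ) (j : ℤ) : ℝ :=
  P.real (X ⁻¹' {j})

/-- The support `S = {j : Pr(X = j) > 0}`. -/
def support {Ω : Type*} [MeasurableSpace Ω] (P : Measure Ω) (X : Ω → ℤ) : Set ℤ :=
  {j | 0 < pmfOf P X j}

/-- `M(X) = |S(X)| - 1`, possibly infinite. -/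
def bigM {Ω : Type*} [MeasurableSpace Ω] (P : Measure Ω) (X : Ω → ℤ) : ℕ∞ :=
  (support P X).encard - 1

/-- `X ∼ CO(μ; δ, β, γ)`: the integer-valued random variable `X` has finite mean `μ`, and
`∑_{k ≤ j} (μ - k) p(k) = q(j) p(j)` for all integers `j`, where `q(j) = δ j² + β j + γ`. -/
structure IsCO {Ω : Type*} [MeasurableSpace Ω] (P : Measure Ω) (X : Ω → ℤ)
    (μ δ β γ : ℝ) : Prop where
  measurable : Measurable X
  integrable : Integrable (fun ω => (X ω : ℝ)) P
  mean_eq : ∫ ω, (X ω : ℝ) ∂P = μ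
  cumulative : ∀ j : ℤ,
    ∑' k : Set.Iic j, (μ - ((k : ℤ) : ℝ)) * pmfOf P X (k : ℤ) = quad δ β γ j * pmfOf P X j

/-- The class `𝒞` of the cumulative Ord random variables with `δ ≤ 0` or finite support. -/
def InClassC {Ω : Type*} [MeasurableSpace Ω] (P : Measure Ω) (X : Ω → ℤ) : Prop :=
  ∃ μ δ β γ : ℝ, IsCO P X μ δ β γ ∧ (δ ≤ 0 ∨ (support P X).Finite)

/-- `p` is a probability mass function on the integers. -/
def IsPmf (p : ℤ → ℝ) : Prop := (∀ j, 0 ≤ p j) ∧ HasSum p 1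

/-- The law on the integers whose probability mass function is `p`. -/
def lawOf (p : ℤ → ℝ) : Measure ℤ :=
  Measure.count.withDensity (fun j => ENNReal.ofReal (p j))

/-- `A_k = E q^{[k]}(X)`, where `X` has probability mass function `p`. -/
def momentA (p q : ℤ → ℝ) (k : ℕ) : ℝ := ∫ j, ascPow q k j ∂(lawOf p)

/-- `c_k(δ) = ∏_{j=k-1}^{2k-2} (1 - j δ)`. -/
def leadC (k : ℕ) (δ : ℝ) : ℝ :=
  ∏ r ∈ Finset.range k, (1 - ((k : ℝ) - 1 + (r : ℝ)) * δ)

/-- The Rodrigues-type function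
`P_k(j) = (-1)^k Δ^k [q^{[k]}(j-k) p(j-k)] / p(j)` on the support of `p`. -/
def rodrigues (p q : ℤ → ℝ) (k : ℕ) (j : ℤ) : ℝ :=
  (-1) ^ k * diff k (fun t => ascPow q k (t - (k : ℤ)) * p (t - (k : ℤ))) j / p j

/-- The standardized polynomial `φ_k = P_k / (k! c_k(δ) E q^{[k]}(X))^{1/2}`, for a probability
mass function `p` and a quadratic `q` with leading coefficient `δ`. -/
def stdPoly (p q : ℤ → ℝ) (δ : ℝ) (k : ℕ) (j : ℤ) : ℝ :=
  rodrigues p q k j / Real.sqrt ((k.factorial : ℝ) * leadC k δ * momentA p q k)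

/-- `p_i(j) = q^{[i]}(j) p(j) / E q^{[i]}(X)`. -/
def pmfI (p q : ℤ → ℝ) (i : ℕ) (j : ℤ) : ℝ := ascPow q i j * p j / momentA p q i

/-- `q_i(j) = q(j+i) / (1 - 2iδ)`, for a quadratic `q` with leading coefficient `δ`. -/
def quadI (q : ℤ → ℝ) (δ : ℝ) (i : ℕ) (j : ℤ) : ℝ := q (j + (i : ℤ)) / (1 - 2 * (i : ℝ) * δ)

/-- The leading coefficient `δ_i = δ / (1 - 2iδ)` of `q_i`. -/
def deltaI (δ : ℝ) (i : ℕ) : ℝ := δ / (1 - 2 * (i : ℝ) * δ)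

/-- `φ_{k,i}`, the standardized polynomial of degree `k` that belongs to `(p_i, q_i)`. -/
def stdPolyI (p q : ℤ → ℝ) (δ : ℝ) (k i : ℕ) : ℤ → ℝ :=
  stdPoly (pmfI p q i) (quadI q δ i) (deltaI δ i) k

/-- `k! ∏_{j=k-1}^{k+i-2} (1 - j δ) / (k-i)!`, used for `i ≤ k`. -/
def weight (δ : ℝ) (k i : ℕ) : ℝ :=
  (k.factorial : ℝ) * (∏ r ∈ Finset.range i, (1 - ((k : ℝ) - 1 + (r : ℝ)) * δ)) /
    ((k - i).factorial : ℝ)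

/-- `v^{(i)}_{k-i} = (k! ∏_{j=k-1}^{k+i-2} (1 - j δ) / ((k-i)! E q^{[i]}(X)))^{1/2}`, for `i ≤ k`. -/
def coeffV (p q : ℤ → ℝ) (δ : ℝ) (k i : ℕ) : ℝ := Real.sqrt (weight δ k i / momentA p q i)

end CumOrd

end

/-!
Write `w_i = q^{[i]} p`. The Cumulative Ord identity says that the backward difference of `w_1` is
a linear polynomial times `w_0`. Iterating it (Rodrigues) shows that the `t`-th negated backward
difference of `w_{i+t}` is `w_i` times a polynomial of degree at most `t` whose leading coefficient
is explicit in `δ`. Up to normalization, `φ_k p` is the case `i = 0`, `t = k`, and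
`φ_{k-i,i} p_i` is the case `t = k - i`. Hence moving `i` differences from the weight to `g` by
summation by parts proves (a). The boundary terms vanish because the differenced weight is
eventually monotone and tends to zero.

For (b), the polynomials of level `i` are orthogonal with respect to `w_i`. For `δ ≤ 0` the ratio
test gives `p` an exponential moment, as finite support does trivially, so an `L²(w_i)` function is
determined by its moments against `w_i` and these polynomials are complete. Hence Parseval's
identity holds at level `i` as soon as `Δ^i g ∈ L²(w_i)`, and this passes down from `i = n` by a
Poincaré inequality relating `w_{i+1}` to `w_i`.
-/

noncomputable section

namespace CumOrd

open Filter Topology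

/-! ### Polynomial functions on the integers -/

/-- `f` is the restriction to `ℤ` of a real polynomial of degree at most `n` whose coefficient of
degree `n` is `c`; the value `c = 0` is allowed. -/
def HasLead (n : ℕ) (c : ℝ) (f : ℤ → ℝ) : Prop :=
  ∃ P : Polynomial ℝ, P.natDegree ≤ n ∧ P.coeff n = c ∧ ∀ j, f j = P.eval (j : ℝ)

/-- `f` has constant (weak) sign along the filter `l`. -/
def EventuallySigned {α : Type*} (l : Filter α) (f : α → ℝ) : Prop :=
  (∀ᶠ x in l, 0 ≤ f x) ∨ ∀ᶠ x in l, f x ≤ 0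

namespace EventuallySigned

variable {α β : Type*} {l : Filter α} {f w : α → ℝ}

theorem comp_tendsto (hf : EventuallySigned l f) {m : Filter β} {u : β → α} (hu : Tendsto u m l) :
    EventuallySigned m (f ∘ u) :=
  hf.imp (fun h => hu.eventually h) fun h => hu.eventually h

theorem neg (hf : EventuallySigned l f) : EventuallySigned l (-f) :=
  hf.symm.imp (fun h => h.mono fun _ => neg_nonneg.2) fun h => h.mono fun _ => neg_nonpos.2

theorem mul_nonneg (hf : EventuallySigned l f) (hw : ∀ x, 0 ≤ w x) :
    EventuallySigned l fun x => f x * w x :=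
  hf.imp (fun h => h.mono fun x hx => _root_.mul_nonneg hx (hw x))
    fun h => h.mono fun x hx => mul_nonpos_of_nonpos_of_nonneg hx (hw x)

theorem polynomial_eval_atTop (P : Polynomial ℝ) :
    EventuallySigned atTop fun x : ℝ => P.eval x := by
  by_cases hd : 0 < P.degree
  · rcases le_total 0 P.leadingCoeff with h | h
    · exact .inl ((P.tendsto_atTop_of_leadingCoeff_nonneg hd h).eventually_ge_atTop 0)
    · exact .inr ((P.tendsto_atBot_of_leadingCoeff_nonpos hd h).eventually_le_atBot 0)
  · rw [Polynomial.eq_C_of_degree_le_zero (not_lt.1 hd)]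
    exact (le_total 0 (P.coeff 0)).imp (fun h => .of_forall fun x => by simpa using h)
      fun h => .of_forall fun x => by simpa using h

end EventuallySigned

namespace HasLead

open Polynomial

variable {n m : ℕ} {c d : ℝ} {f g : ℤ → ℝ}

theorem const (c : ℝ) : HasLead 0 c (fun _ => c) :=
  ⟨C c, by simp, by simp, by simp⟩

theorem cast : HasLead 1 1 (fun j => (j : ℝ)) :=
  ⟨X, by simp, by simp, by simp⟩

theorem add (hf : HasLead n c f) (hg : HasLead n d g) : HasLead n (c + d) (fun j => f j + g j) := by
  obtain ⟨P, hP, rfl, hPf⟩ := hf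
  obtain ⟨Q, hQ, rfl, hQg⟩ := hg
  exact ⟨P + Q, natDegree_add_le_of_degree_le hP hQ, coeff_add .., fun j => by simp [hPf, hQg]⟩

theorem mul (hf : HasLead n c f) (hg : HasLead m d g) :
    HasLead (n + m) (c * d) (fun j => f j * g j) := by
  obtain ⟨P, hP, rfl, hPf⟩ := hf
  obtain ⟨Q, hQ, rfl, hQg⟩ := hg
  exact ⟨P * Q, natDegree_mul_le_of_le hP hQ, coeff_mul_add_eq_of_natDegree_le hP hQ,
    fun j => by simp [hPf, hQg]⟩

theorem const_mul (hf : HasLead n c f) (a : ℝ) : HasLead n (a * c) (fun j => a * f j) := by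
  simpa only [zero_add] using (const a).mul hf

theorem sub (hf : HasLead n c f) (hg : HasLead n d g) : HasLead n (c - d) (fun j => f j - g j) := by
  simpa only [sub_eq_add_neg, neg_one_mul] using hf.add (hg.const_mul (-1))

theorem of_lt (hf : HasLead n c f) (h : n < m) : HasLead m 0 f := by
  obtain ⟨P, hP, -, hPf⟩ := hf
  exact ⟨P, hP.trans h.le, coeff_eq_zero_of_natDegree_lt (hP.trans_lt h), hPf⟩

theorem pow (hf : HasLead 1 c f) : ∀ N : ℕ, HasLead N (c ^ N) fun j => f j ^ N
  | 0 => by simpa only [pow_zero] using const 1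
  | N + 1 => by simpa only [pow_succ] using (hf.pow N).mul hf

theorem shift (hf : HasLead n c f) (s : ℤ) : HasLead n c (fun j => f (j + s)) := by
  obtain ⟨P, hP, rfl, hPf⟩ := hf
  refine ⟨taylor (s : ℝ) P, by simpa using hP, ?_, fun j => by simp [hPf, taylor_eval]⟩
  rw [taylor_coeff, eval_eq_sum_range' (n := 1)]
  · simp [hasseDeriv_coeff]
  · have := natDegree_hasseDeriv_le P n
    omega

theorem shift_sub (hf : HasLead (n + 1) c f) (s : ℤ) :
    HasLead n ((n + 1) * c * s) (fun j => f (j + s) - f j) := by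
  obtain ⟨P, hP, rfl, hPf⟩ := hf
  have hcoeff (k : ℕ) (hk : n ≤ k) : (taylor (s : ℝ) P - P).coeff k =
      (k + 1) * P.coeff (k + 1) * s := by
    rw [coeff_sub, taylor_coeff, eval_eq_sum_range' (n := 2)]
    · simp [Finset.sum_range_succ, hasseDeriv_coeff, add_comm 1]
    · have := natDegree_hasseDeriv_le P k
      omega
  refine ⟨taylor (s : ℝ) P - P, natDegree_le_iff_coeff_eq_zero.2 fun k hk => ?_,
    hcoeff n le_rfl, fun j => by simp [hPf, taylor_eval]⟩
  rw [hcoeff k hk.le, coeff_eq_zero_of_natDegree_lt (by omega), mul_zero, zero_mul]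

theorem eq_of_degree_zero (hf : HasLead 0 c f) (j : ℤ) : f j = c := by
  obtain ⟨P, hP, rfl, hPf⟩ := hf
  rw [hPf, eq_C_of_natDegree_le_zero hP]
  simp

theorem exists_eq_linear (hf : HasLead 1 c f) : ∃ b, ∀ j : ℤ, f j = c * j + b := by
  obtain ⟨P, hP, rfl, hPf⟩ := hf
  refine ⟨P.coeff 0, fun j => ?_⟩
  rw [hPf, eval_eq_sum_range' (Nat.lt_succ_of_le hP)]
  simp [Finset.sum_range_succ, add_comm]

theorem exists_eq_quad (hf : HasLead 2 c f) : ∃ β γ, f = quad c β γ := by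
  obtain ⟨P, hP, rfl, hPf⟩ := hf
  refine ⟨P.coeff 1, P.coeff 0, funext fun j => ?_⟩
  rw [hPf, eval_eq_sum_range' (Nat.lt_succ_of_le hP), quad]
  simp only [Finset.sum_range_succ, Finset.sum_range_zero]
  ring

protected theorem quad (δ β γ : ℝ) : HasLead 2 δ (quad δ β γ) := by
  have := (((cast.pow 2).const_mul δ).add ((cast.const_mul β).of_lt one_lt_two)).add
    ((const γ).of_lt two_pos)
  rwa [one_pow, mul_one, add_zero, add_zero] at this

theorem diff_eq (hf : HasLead n c f) (j : ℤ) : diff n f j = n.factorial * c := by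
  induction n generalizing c f with
  | zero => simpa [diff] using hf.eq_of_degree_zero j
  | succ n ih =>
    have hstep : diff (n + 1) f j = diff n (fun j => f (j + 1) - f j) j := rfl
    rw [hstep, ih (hf.shift_sub 1), Nat.factorial_succ]
    push_cast
    ring

theorem exists_abs_le (hf : HasLead n c f) : ∃ K, ∀ j, |f j| ≤ K * (1 + |(j : ℝ)|) ^ n := by
  obtain ⟨P, hP, -, hPf⟩ := hf
  refine ⟨∑ i ∈ Finset.range (n + 1), |P.coeff i|, fun j => ?_⟩
  rw [hPf, eval_eq_sum_range' (Nat.lt_succ_of_le hP), Finset.sum_mul]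
  refine (Finset.abs_sum_le_sum_abs _ _).trans (Finset.sum_le_sum fun i hi => ?_)
  have hi' : i ≤ n := Finset.mem_range_succ_iff.1 hi
  rw [abs_mul, abs_pow]
  gcongr
  calc |(j : ℝ)| ^ i ≤ (1 + |(j : ℝ)|) ^ i := by gcongr; linarith
    _ ≤ (1 + |(j : ℝ)|) ^ n := pow_le_pow_right₀ (by linarith [abs_nonneg (j : ℝ)]) hi'

theorem eventuallySigned_atTop (hf : HasLead n c f) : EventuallySigned atTop f := by
  obtain ⟨P, -, -, hPf⟩ := hf
  rw [funext hPf]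
  exact (EventuallySigned.polynomial_eval_atTop P).comp_tendsto tendsto_intCast_atTop_atTop

theorem eventuallySigned_atBot (hf : HasLead n c f) : EventuallySigned atBot f := by
  obtain ⟨P, -, -, hPf⟩ := hf
  have hneg : Tendsto (fun j : ℤ => -(j : ℝ)) atBot atTop :=
    tendsto_neg_atBot_atTop.comp (tendsto_intCast_atBot_iff.2 tendsto_id)
  have hreflect : f = (fun x => (P.comp (-X)).eval x) ∘ fun j : ℤ => -(j : ℝ) := by
    funext j
    simp [hPf]
  exact hreflect ▸ (EventuallySigned.polynomial_eval_atTop _).comp_tendsto hneg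

end HasLead

/-! ### Summation by parts -/

/-- The negated backward difference `C(j - 1) - C(j)`, the adjoint of the forward difference. -/
def backDiff (C : ℤ → ℝ) (j : ℤ) : ℝ := C (j - 1) - C j

theorem sum_range_mul_by_parts (c h : ℕ → ℝ) (N : ℕ) :
    ∑ n ∈ Finset.range N, (c n - c (n + 1)) * h n =
      c 0 * h 0 - c N * h N + ∑ n ∈ Finset.range N, c (n + 1) * (h (n + 1) - h n) := by
  induction N with
  | zero => simp
  | succ N ih => rw [Finset.sum_range_succ, Finset.sum_range_succ, ih]; ring

section HalfLine

variable {c h : ℕ → ℝ} (hs : Summable fun n => c (n + 1) * (h (n + 1) - h n))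

include hs

theorem summable_mul_of_antitone_of_monotone (hc : Antitone c) (hc0 : ∀ n, 0 ≤ c n)
    (hh : ∀ n, 0 ≤ h n) (hhmono : Monotone h) : Summable fun n => (c n - c (n + 1)) * h n := by
  refine summable_of_sum_range_le
    (c := c 0 * h 0 + ∑' n, c (n + 1) * (h (n + 1) - h n))
    (fun n => mul_nonneg (sub_nonneg.2 (hc n.le_succ)) (hh n)) fun N => ?_
  rw [sum_range_mul_by_parts]
  have hboundary := mul_nonneg (hc0 N) (hh N)
  have htail := hs.sum_le_tsum (Finset.range N)
    fun n _ => mul_nonneg (hc0 _) (sub_nonneg.2 (hhmono n.le_succ))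
  linarith

theorem tendsto_mul_of_antitone_of_monotone (hc : Antitone c) (hlim : Tendsto c atTop (𝓝 0))
    (hh : ∀ n, 0 ≤ h n) (hhmono : Monotone h) :
    Tendsto (fun n => c n * h n) atTop (𝓝 0) := by
  have hc0 : ∀ n, 0 ≤ c n := hc.le_of_tendsto hlim
  have hsum := (summable_mul_of_antitone_of_monotone hs hc hc0 hh hhmono).hasSum.tendsto_sum_nat
  set s : ℕ → ℝ := fun N => ∑ n ∈ Finset.range N, (c n - c (n + 1)) * h n
  set S : ℝ := ∑' n, (c n - c (n + 1)) * h n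
  have hblock (N M : ℕ) (hNM : N ≤ M) : (c N - c M) * h N ≤ s M - s N := by
    induction M, hNM using Nat.le_induction with
    | base => simp
    | succ M hNM ih =>
      have hlast : s (M + 1) = s M + (c M - c (M + 1)) * h M := Finset.sum_range_succ ..
      have := mul_le_mul_of_nonneg_left (hhmono hNM) (sub_nonneg.2 (hc M.le_succ))
      linarith
  have htail (N : ℕ) : c N * h N ≤ S - s N := by
    have hlimit := (hlim.const_sub (c N)).mul_const (h N)
    rw [sub_zero] at hlimit
    exact le_of_tendsto_of_tendsto hlimit (hsum.sub_const (s N))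
      ((eventually_ge_atTop N).mono (hblock N))
  refine squeeze_zero (fun n => mul_nonneg (hc0 n) (hh n)) htail ?_
  simpa using hsum.const_sub S

/- Replacing `h` by its total variation `|h 0| + ∑ m < n, |h (m + 1) - h m|` reduces to the
monotone case. -/
theorem summable_and_tendsto_mul_of_antitone (hc : Antitone c) (hlim : Tendsto c atTop (𝓝 0)) :
    (Summable fun n => (c n - c (n + 1)) * h n) ∧ Tendsto (fun n => c n * h n) atTop (𝓝 0) := by
  have hc0 : ∀ n, 0 ≤ c n := hc.le_of_tendsto hlim
  set V : ℕ → ℝ := fun n => |h 0| + ∑ m ∈ Finset.range n, |h (m + 1) - h m|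
  have hVsucc (n : ℕ) : V (n + 1) - V n = |h (n + 1) - h n| := by
    simp only [V, Finset.sum_range_succ]
    ring
  have hVmono : Monotone V := monotone_nat_of_le_succ fun n =>
    sub_nonneg.1 ((hVsucc n).symm ▸ abs_nonneg _)
  have hhV (n : ℕ) : |h n| ≤ V n := by
    induction n with
    | zero => simp [V]
    | succ n ih =>
      have := abs_add_le (h n) (h (n + 1) - h n)
      rw [add_sub_cancel] at this
      linarith [hVsucc n]
  have hV0 (n : ℕ) : 0 ≤ V n := (abs_nonneg _).trans (hhV n)
  have hsV : Summable fun n => c (n + 1) * (V (n + 1) - V n) :=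
    hs.abs.congr fun n => by rw [hVsucc, abs_mul, abs_of_nonneg (hc0 _)]
  refine ⟨.of_norm_bounded (summable_mul_of_antitone_of_monotone hsV hc hc0 hV0 hVmono) fun n => ?_,
    squeeze_zero_norm (fun n => ?_) (tendsto_mul_of_antitone_of_monotone hsV hc hlim hV0 hVmono)⟩
  · rw [norm_mul, Real.norm_of_nonneg (sub_nonneg.2 (hc n.le_succ))]
    exact mul_le_mul_of_nonneg_left (hhV n) (sub_nonneg.2 (hc n.le_succ))
  · rw [norm_mul, Real.norm_of_nonneg (hc0 n)]
    exact mul_le_mul_of_nonneg_left (hhV n) (hc0 n)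

theorem summable_and_tendsto_mul_of_eventuallySigned (hlim : Tendsto c atTop (𝓝 0))
    (hsign : EventuallySigned atTop fun n => c n - c (n + 1)) :
    (Summable fun n => (c n - c (n + 1)) * h n) ∧ Tendsto (fun n => c n * h n) atTop (𝓝 0) := by
  wlog hpos : ∀ᶠ n in atTop, 0 ≤ c n - c (n + 1) generalizing c
  · have hneg : ∀ᶠ n in atTop, 0 ≤ -c n - -c (n + 1) :=
      (hsign.resolve_left hpos).mono fun n hn => by linarith
    obtain ⟨hsum, hlim'⟩ := this (c := fun n => -c n) (hs.neg.congr fun n => by ring)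
      (by simpa using hlim.neg) (.inl hneg) hneg
    exact ⟨hsum.neg.congr fun n => by ring, by simpa using hlim'.neg⟩
  obtain ⟨N, hN⟩ := eventually_atTop.1 hpos
  have hanti : Antitone fun n => c (n + N) := antitone_nat_of_succ_le fun n => by
    simpa only [add_right_comm n 1 N] using sub_nonneg.1 (hN (n + N) (Nat.le_add_left N n))
  have hsN : Summable fun n => c (n + 1 + N) * (h (n + 1 + N) - h (n + N)) := by
    simpa only [add_right_comm _ 1 N] using (summable_nat_add_iff N).2 hs
  obtain ⟨hsum, hlim'⟩ := summable_and_tendsto_mul_of_antitone (c := fun n => c (n + N))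
    (h := fun n => h (n + N)) hsN hanti ((tendsto_add_atTop_iff_nat N).2 hlim)
  refine ⟨(summable_nat_add_iff N).1 ?_, (tendsto_add_atTop_iff_nat N).1 hlim'⟩
  simpa only [add_right_comm _ 1 N] using hsum

theorem hasSum_mul_by_parts_nat (hlim : Tendsto c atTop (𝓝 0))
    (hsign : EventuallySigned atTop fun n => c n - c (n + 1)) :
    HasSum (fun n => (c n - c (n + 1)) * h n)
      (c 0 * h 0 + ∑' n, c (n + 1) * (h (n + 1) - h n)) := by
  obtain ⟨hsum, hboundary⟩ := summable_and_tendsto_mul_of_eventuallySigned hs hlim hsign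
  rw [hsum.hasSum_iff_tendsto_nat]
  simp only [sum_range_mul_by_parts]
  simpa using (hboundary.const_sub (c 0 * h 0)).add hs.hasSum.tendsto_sum_nat

end HalfLine

theorem hasSum_natCast_backDiff_mul {C h : ℤ → ℝ} (hlim : Tendsto C atTop (𝓝 0))
    (hsign : EventuallySigned atTop (backDiff C))
    (hs : Summable fun n : ℕ => C n * (h (n + 1) - h n)) :
    HasSum (fun n : ℕ => backDiff C n * h n)
      (C (-1) * h 0 + ∑' n : ℕ, C n * (h (n + 1) - h n)) := by
  have hshift : Tendsto (fun n : ℕ => (n : ℤ) + -1) atTop atTop :=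
    tendsto_atTop_add_const_right atTop (-1 : ℤ) tendsto_natCast_atTop_atTop
  have hstep (n : ℕ) : C (n + -1) - C ((n + 1 : ℕ) + -1) = backDiff C n := by
    rw [backDiff, Nat.cast_succ, add_neg_cancel_right, ← sub_eq_add_neg]
  have := hasSum_mul_by_parts_nat (c := fun n : ℕ => C (n + -1)) (h := fun n : ℕ => h n)
    (by simpa using hs) (hlim.comp hshift)
    (by simp only [hstep]; exact hsign.comp_tendsto tendsto_natCast_atTop_atTop)
  simp only [hstep] at this
  simpa using this

theorem hasSum_backDiff_mul {C h : ℤ → ℝ} (htop : Tendsto C atTop (𝓝 0))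
    (hbot : Tendsto C atBot (𝓝 0)) (hsignTop : EventuallySigned atTop (backDiff C))
    (hsignBot : EventuallySigned atBot (backDiff C))
    (hs : Summable fun j => C j * (h (j + 1) - h j)) :
    HasSum (fun j => backDiff C j * h j) (∑' j, C j * (h (j + 1) - h j)) := by
  obtain ⟨D, hD⟩ : ∃ D : ℤ → ℝ, ∀ j, D j = C j * (h (j + 1) - h j) := ⟨_, fun _ => rfl⟩
  simp only [← hD] at hs ⊢
  have hsNat : Summable fun n : ℕ => D n := hs.comp_injective Nat.cast_injective
  have hsNeg : Summable fun n : ℕ => D (-(n + 1)) :=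
    hs.comp_injective (i := fun n : ℕ => -((n : ℤ) + 1)) fun a b => by simp
  have hreflect (a : ℤ) : Tendsto (fun j : ℤ => -j + -a) atTop atBot :=
    tendsto_atBot_add_const_right atTop (-a) tendsto_neg_atTop_atBot
  have hright := hasSum_natCast_backDiff_mul htop hsignTop (h := h) (by simpa only [← hD])
  have hstep : backDiff (fun j => C (-j + -2)) = -(backDiff C ∘ fun j => -j + -1) := by
    funext j
    simp only [backDiff, Pi.neg_apply, Function.comp_apply]
    ring_nf
  have hDneg (n : ℕ) :
      C (-n + -2) * (h (-(n + 1) + -1) - h (-n + -1)) = -D (-((n + 1 : ℕ) + 1)) := by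
    rw [hD]
    push_cast
    ring_nf
  have hleft := hasSum_natCast_backDiff_mul (C := fun j => C (-j + -2)) (h := fun j => h (-j + -1))
    (hbot.comp (hreflect 2)) (hstep ▸ (hsignBot.comp_tendsto (hreflect 1)).neg)
    (by simpa only [hDneg] using ((summable_nat_add_iff 1).2 hsNeg).neg)
  simp only [hDneg, hstep, tsum_neg, Pi.neg_apply, Function.comp_apply, neg_mul] at hleft
  replace hleft := hleft.neg
  simp only [neg_neg, ← neg_add_rev, add_comm (1 : ℤ)] at hleft
  simp only [← hD] at hright
  convert hright.of_nat_of_neg_add_one (f := fun j => backDiff C j * h j) hleft using 1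
  rw [tsum_of_nat_of_neg_add_one hsNat hsNeg, hsNeg.tsum_eq_zero_add, hD (-((0 : ℕ) + 1))]
  norm_num
  ring

theorem neg_one_pow_mul_diff_sub (t : ℕ) (w : ℤ → ℝ) (j : ℤ) :
    (-1) ^ t * diff t (fun x => w (x - t)) j = backDiff^[t] w j := by
  induction t generalizing j with
  | zero => simp [diff]
  | succ t ih =>
    have hshift : (fun x : ℤ => w (x - (t + 1 : ℕ))) =
        fun x => (fun y => w (y - t)) (x + (-1)) := by
      funext x
      push_cast
      ring_nf
    have hcomm : diff (t + 1) (fun x => (fun y => w (y - t)) (x + (-1))) j =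
        diff (t + 1) (fun y => w (y - t)) (j - 1) :=
      fwdDiff_iter_comp_add 1 (fun y => w (y - t)) (-1) (t + 1) j
    rw [hshift, hcomm, Function.iterate_succ_apply', backDiff, ← ih, ← ih]
    simp only [diff, Function.iterate_succ_apply', fwdDiff, sub_add_cancel]
    ring

theorem iterate_backDiff_const_mul (t : ℕ) (c : ℝ) (w : ℤ → ℝ) (j : ℤ) :
    backDiff^[t] (fun x => c * w x) j = c * backDiff^[t] w j := by
  induction t generalizing j with
  | zero => rfl
  | succ t ih =>
    simp only [Function.iterate_succ_apply', backDiff, ih]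
    ring

/-! ### Weights of an Ord sequence -/

theorem ascPow_zero (q : ℤ → ℝ) (j : ℤ) : ascPow q 0 j = 1 := Finset.prod_range_zero _

theorem ascPow_add (q : ℤ → ℝ) (i t : ℕ) (j : ℤ) :
    ascPow q (i + t) j = ascPow q i j * ascPow q t (j + i) := by
  simp only [ascPow, Finset.prod_range_add, Nat.cast_add, add_assoc]

theorem ascPow_one (q : ℤ → ℝ) (j : ℤ) : ascPow q 1 j = q j := by simp [ascPow]

theorem HasLead.ascPow {q : ℤ → ℝ} {n : ℕ} {c : ℝ} (hq : HasLead n c q) (i : ℕ) :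
    HasLead (n * i) (c ^ i) (ascPow q i) := by
  induction i with
  | zero => simpa [funext (ascPow_zero q)] using HasLead.const 1
  | succ i ih =>
    simpa only [funext (ascPow_add q i 1), ascPow_one, pow_succ, mul_add_one] using
      ih.mul (hq.shift i)

/-- The weight `w_i = q^{[i]} p`, the unnormalized probability mass function of `X_i`. -/
def wt (p q : ℤ → ℝ) (i : ℕ) (j : ℤ) : ℝ := ascPow q i j * p j

theorem wt_zero (p q : ℤ → ℝ) : wt p q 0 = p := by
  funext j
  rw [wt, ascPow_zero, one_mul]

theorem wt_add (p q : ℤ → ℝ) (i t : ℕ) (j : ℤ) :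
    wt p q (i + t) j = ascPow q t (j + i) * wt p q i j := by
  rw [wt, wt, ascPow_add]
  ring

theorem wt_succ (p q : ℤ → ℝ) (i : ℕ) (j : ℤ) : wt p q (i + 1) j = q (j + i) * wt p q i j := by
  rw [wt_add, ascPow_one]

/-- `p` is a nonnegative sequence solving the difference form
`q(j) p(j) - q(j-1) p(j-1) = (μ - j) p(j)` of the cumulative Ord relation, whose flux `q p` vanishes
at `±∞`, where `q` is a quadratic with leading coefficient `δ`. -/
structure IsOrdSeq (p q : ℤ → ℝ) (μ δ : ℝ) : Prop where
  nonneg : ∀ j, 0 ≤ p j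
  hasLead : HasLead 2 δ q
  flux_sub : ∀ j : ℤ, q j * p j - q (j - 1) * p (j - 1) = (μ - j) * p j
  tendsto_atTop : Tendsto (fun j => q j * p j) atTop (𝓝 0)
  tendsto_atBot : Tendsto (fun j => q j * p j) atBot (𝓝 0)

/-- `p` has a finite absolute moment of order `N`. -/
def HasMoment (p : ℤ → ℝ) (N : ℕ) : Prop := Summable fun j : ℤ => (1 + |(j : ℝ)|) ^ N * p j

theorem HasMoment.summable_mul {p : ℤ → ℝ} (hp : ∀ j, 0 ≤ p j) {N : ℕ} (hm : HasMoment p N)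
    {n : ℕ} {c : ℝ} {f : ℤ → ℝ} (hf : HasLead n c f) (hn : n ≤ N) :
    Summable fun j => f j * p j := by
  obtain ⟨K, hK⟩ := hf.exists_abs_le
  have hK0 : 0 ≤ K := by simpa using (abs_nonneg _).trans (hK 0)
  refine .of_norm_bounded (hm.mul_left K) fun j => ?_
  rw [norm_mul, Real.norm_of_nonneg (hp j), ← mul_assoc]
  refine mul_le_mul_of_nonneg_right ((hK j).trans ?_) (hp j)
  gcongr
  linarith [abs_nonneg (j : ℝ)]

/-- The product `∏_{r < t} (1 - (2i + t - 1 + r) δ)`, the leading coefficient of the polynomial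
`(-1)^t Δ^t[w_{i+t}(j - t)] / w_i(j)` of degree `t`. -/
def leadCoef (δ : ℝ) (i t : ℕ) : ℝ :=
  ∏ r ∈ Finset.range t, (1 - (2 * (i : ℝ) + t - 1 + r) * δ)

theorem leadCoef_zero (δ : ℝ) (i : ℕ) : leadCoef δ i 0 = 1 := Finset.prod_range_zero _

theorem leadCoef_succ (δ : ℝ) (i t : ℕ) :
    leadCoef δ i (t + 1) = (1 - (2 * (i : ℝ) + t) * δ) * leadCoef δ (i + 1) t := by
  rw [leadCoef, Finset.prod_range_succ', mul_comm, leadCoef]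
  push_cast
  ring_nf

namespace IsOrdSeq

variable {p q : ℤ → ℝ} {μ δ : ℝ} (H : IsOrdSeq p q μ δ)

include H

section Support

theorem flux_mono {i j : ℤ} (hj : (j : ℝ) ≤ μ) (hij : i ≤ j) : q i * p i ≤ q j * p j := by
  induction i, hij using Int.leInductionDown with
  | base => exact le_rfl
  | pred n hn ih =>
    have : (n : ℝ) ≤ j := by exact_mod_cast hn
    have := mul_nonneg (by linarith : 0 ≤ μ - n) (H.nonneg n)
    linarith [H.flux_sub n]

theorem flux_anti {i j : ℤ} (hj : μ ≤ (j : ℝ) + 1) (hji : j ≤ i) : q i * p i ≤ q j * p j := by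
  induction i, hji using Int.leInduction with
  | base => exact le_rfl
  | succ n hn ih =>
    have : (j : ℝ) ≤ n := by exact_mod_cast hn
    have hflux := H.flux_sub (n + 1)
    rw [add_sub_cancel_right] at hflux
    push_cast at hflux
    have := mul_nonneg (by linarith : 0 ≤ (n : ℝ) + 1 - μ) (H.nonneg (n + 1))
    linarith

theorem flux_nonneg (j : ℤ) : 0 ≤ q j * p j := by
  rcases le_total (j : ℝ) μ with hj | hj
  · exact le_of_tendsto H.tendsto_atBot
      ((eventually_le_atBot j).mono fun i hi => H.flux_mono hj hi)
  · exact le_of_tendsto H.tendsto_atTop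
      ((eventually_ge_atTop j).mono fun i hi => H.flux_anti (by linarith) hi)

theorem flux_pos {a b j : ℤ} (ha : 0 < p a) (hb : 0 < p b) (haj : a ≤ j) (hjb : j < b) :
    0 < q j * p j := by
  have haj' : (a : ℝ) ≤ j := by exact_mod_cast haj
  have hjb' : (j : ℝ) + 1 ≤ b := by exact_mod_cast hjb
  rcases lt_or_ge (j : ℝ) μ with hj | hj
  · refine lt_of_lt_of_le ?_ (H.flux_mono hj.le haj)
    have := mul_pos (by linarith : 0 < μ - a) ha
    linarith [H.flux_sub a, H.flux_nonneg (a - 1)]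
  · refine lt_of_lt_of_le ?_ (H.flux_anti (by linarith) (Int.le_sub_one_of_lt hjb))
    have := mul_pos (by linarith : 0 < (b : ℝ) - μ) hb
    linarith [H.flux_sub b, H.flux_nonneg b]

theorem pos_succ_of_flux_ne_zero {j : ℤ} (hj : q j * p j ≠ 0) : 0 < p (j + 1) := by
  refine (H.nonneg _).lt_of_ne' fun h0 => ?_
  have := H.flux_sub (j + 1)
  rw [h0, add_sub_cancel_right, mul_zero, mul_zero, zero_sub] at this
  exact hj (neg_eq_zero.1 this)

theorem wt_pos {i : ℕ} {j : ℤ} (hj : 0 < p j) (hji : 0 < p (j + i)) : 0 < wt p q i j := by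
  refine mul_pos (Finset.prod_pos fun r hr => ?_) hj
  have hr : r < i := Finset.mem_range.1 hr
  exact pos_of_mul_pos_left (H.flux_pos hj hji (by omega : j ≤ j + r) (by omega)) (H.nonneg _)

theorem pos_and_pos_of_wt_ne_zero {i : ℕ} {j : ℤ} (h : wt p q i j ≠ 0) :
    0 < p j ∧ 0 < p (j + i) := by
  induction i with
  | zero =>
    rw [wt_zero] at h
    simpa using (H.nonneg j).lt_of_ne' h
  | succ i ih =>
    rw [wt_succ, mul_ne_zero_iff] at h
    obtain ⟨hj, hji⟩ := ih h.2
    have := H.pos_succ_of_flux_ne_zero (mul_ne_zero h.1 hji.ne')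
    exact ⟨hj, by rwa [Nat.cast_succ, ← add_assoc]⟩

theorem wt_nonneg (i : ℕ) (j : ℤ) : 0 ≤ wt p q i j := by
  by_cases h : wt p q i j = 0
  · exact h.ge
  · obtain ⟨hj, hji⟩ := H.pos_and_pos_of_wt_ne_zero h
    exact (H.wt_pos hj hji).le

theorem wt_pos_iff {i : ℕ} {j : ℤ} : 0 < wt p q i j ↔ 0 < p j ∧ 0 < p (j + i) :=
  ⟨fun h => H.pos_and_pos_of_wt_ne_zero h.ne', fun h => H.wt_pos h.1 h.2⟩

theorem wt_pos_of_le {i k : ℕ} (hik : i ≤ k) {j : ℤ} (hj : 0 < wt p q k j) : 0 < wt p q i j := by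
  obtain ⟨t, rfl⟩ := Nat.exists_eq_add_of_le hik
  rw [wt_add] at hj
  exact (H.wt_nonneg i j).lt_of_ne' (right_ne_zero_of_mul hj.ne')

end Support

section Rodrigues

theorem wt_succ_pred (i : ℕ) (j : ℤ) :
    wt p q (i + 1) (j - 1) = (q j - μ + j) * wt p q i j := by
  rw [wt, wt, add_comm i, ascPow_add, ascPow_one, Nat.cast_one, sub_add_cancel]
  linear_combination -ascPow q i j * H.flux_sub j

theorem exists_backDiff_mul_wt_succ {t : ℕ} {c : ℝ} {f : ℤ → ℝ} (hf : HasLead t c f) (i : ℕ) :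
    ∃ f', HasLead (t + 1) ((1 - (2 * (i : ℝ) + t) * δ) * c) f' ∧
      backDiff (fun j => f j * wt p q (i + 1) j) = fun j => f' j * wt p q i j := by
  have hdrop : HasLead (t + 1) (-(t * c * δ)) fun j => (f (j + -1) - f j) * q (j + i) := by
    cases t with
    | zero => simpa [hf.eq_of_degree_zero] using (HasLead.const 0).of_lt one_pos
    | succ t =>
      have := (hf.shift_sub (-1)).mul (H.hasLead.shift i)
      rwa [show ((t : ℝ) + 1) * c * ((-1 : ℤ) : ℝ) * δ = -((t + 1 : ℕ) * c * δ) by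
        push_cast; ring] at this
  have hslope : HasLead 1 (2 * i * δ - 1) fun j => q (j + i) - q j + μ - j := by
    have := ((H.hasLead.shift_sub i).add ((HasLead.const μ).of_lt one_pos)).sub HasLead.cast
    rwa [show ((1 : ℕ) + 1) * δ * ((i : ℤ) : ℝ) + 0 - 1 = 2 * i * δ - 1 by
      push_cast; ring] at this
  refine ⟨fun j => (f (j + -1) - f j) * q (j + i) - f (j + -1) * (q (j + i) - q j + μ - j),
    ?_, funext fun j => ?_⟩
  · have := hdrop.sub ((hf.shift (-1)).mul hslope)
    rwa [show -(t * c * δ) - c * (2 * i * δ - 1) = (1 - (2 * (i : ℝ) + t) * δ) * c by ring] at this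
  · simp only [backDiff, H.wt_succ_pred, wt_succ, ← sub_eq_add_neg]
    ring

theorem exists_iterate_backDiff_wt (t i : ℕ) :
    ∃ f, HasLead t (leadCoef δ i t) f ∧
      backDiff^[t] (wt p q (i + t)) = fun j => f j * wt p q i j := by
  induction t generalizing i with
  | zero => exact ⟨fun _ => 1, leadCoef_zero δ i ▸ HasLead.const 1, by simp⟩
  | succ t ih =>
    obtain ⟨f, hf, hfw⟩ := ih (i + 1)
    obtain ⟨f', hf', hfw'⟩ := H.exists_backDiff_mul_wt_succ hf i
    refine ⟨f', leadCoef_succ δ i t ▸ hf', ?_⟩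
    rw [Function.iterate_succ_apply', ← hfw', ← hfw, add_right_comm, add_assoc]

end Rodrigues

section Moments

variable {N : ℕ} (hm : HasMoment p N)

include hm

theorem summable_mul_wt {n i : ℕ} {c : ℝ} {f : ℤ → ℝ} (hf : HasLead n c f)
    (hn : n + 2 * i ≤ N) : Summable fun j => f j * wt p q i j := by
  simp only [wt, ← mul_assoc]
  exact hm.summable_mul H.nonneg (hf.mul (H.hasLead.ascPow i)) hn

theorem summable_wt {i : ℕ} (hn : 2 * i ≤ N) : Summable (wt p q i) := by
  simpa using H.summable_mul_wt hm (HasLead.const 1) (by omega : 0 + 2 * i ≤ N)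

end Moments

section RepeatedSummation

variable {k : ℕ} (hm : HasMoment p (2 * k))

include hm

theorem summable_iterate_backDiff_wt {s : ℕ} (hs : s ≤ k) : Summable (backDiff^[s] (wt p q k)) := by
  obtain ⟨i, rfl⟩ := Nat.exists_eq_add_of_le' hs
  obtain ⟨f, hf, hfw⟩ := H.exists_iterate_backDiff_wt s i
  exact hfw ▸ H.summable_mul_wt hm hf (by omega)

theorem hasSum_iterate_backDiff_succ_mul {s : ℕ} (hs : s < k) {h : ℤ → ℝ}
    (hsum : Summable fun j => backDiff^[s] (wt p q k) j * fwdDiff 1 h j) :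
    HasSum (fun j => backDiff^[s + 1] (wt p q k) j * h j)
      (∑' j, backDiff^[s] (wt p q k) j * fwdDiff 1 h j) := by
  obtain ⟨i, rfl⟩ := Nat.exists_eq_add_of_le' (Nat.succ_le_of_lt hs)
  obtain ⟨f, hf, hfw⟩ := H.exists_iterate_backDiff_wt (s + 1) i
  have hlim := (H.summable_iterate_backDiff_wt hm hs.le).tendsto_cofinite_zero
  rw [Int.cofinite_eq, tendsto_sup] at hlim
  rw [Function.iterate_succ_apply'] at hfw ⊢
  exact hasSum_backDiff_mul hlim.2 hlim.1
    (hfw ▸ hf.eventuallySigned_atTop.mul_nonneg (H.wt_nonneg i))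
    (hfw ▸ hf.eventuallySigned_atBot.mul_nonneg (H.wt_nonneg i)) hsum

theorem hasSum_iterate_backDiff_mul {u t : ℕ} (hk : u + t ≤ k) {h : ℤ → ℝ}
    (hsum : Summable fun j => backDiff^[u] (wt p q k) j * diff t h j) :
    HasSum (fun j => backDiff^[u + t] (wt p q k) j * h j)
      (∑' j, backDiff^[u] (wt p q k) j * diff t h j) := by
  induction t generalizing h with
  | zero => exact hsum.hasSum
  | succ t ih =>
    have hstep := ih (by omega) (h := fwdDiff 1 h) hsum
    have := H.hasSum_iterate_backDiff_succ_mul hm (by omega) hstep.summable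
    rwa [hstep.tsum_eq] at this

end RepeatedSummation

end IsOrdSeq

/-! ### Moments and standardized polynomials -/

section Law

variable {p : ℤ → ℝ} (hp : ∀ j, 0 ≤ p j) (f : ℤ → ℝ)

include hp

theorem integrable_lawOf_iff : Integrable f (lawOf p) ↔ Summable fun j => f j * p j := by
  rw [lawOf, integrable_withDensity_iff_integrable_smul' (measurable_of_countable _)
    (ae_of_all _ fun _ => ENNReal.ofReal_lt_top), integrable_count_iff,
    ← summable_norm_iff (f := fun j => f j * p j)]
  simp only [ENNReal.toReal_ofReal (hp _), smul_eq_mul, mul_comm]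

theorem integral_lawOf : ∫ j, f j ∂(lawOf p) = ∑' j, f j * p j := by
  by_cases hf : Integrable f (lawOf p)
  · have hs : Summable fun j => ‖p j * f j‖ :=
      ((integrable_lawOf_iff hp f).1 hf).norm.congr fun j => by rw [mul_comm]
    rw [lawOf, integral_withDensity_eq_integral_toReal_smul (measurable_of_countable _)
      (ae_of_all _ fun _ => ENNReal.ofReal_lt_top)]
    simp only [ENNReal.toReal_ofReal (hp _), smul_eq_mul]
    rw [integral_countable (integrable_count_iff.2 hs)]
    simp [Measure.real, mul_comm]
  · rw [integral_undef hf, tsum_eq_zero_of_not_summable (mt (integrable_lawOf_iff hp f).2 hf)]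

theorem memLp_two_lawOf_iff : MemLp f 2 (lawOf p) ↔ Summable fun j => f j ^ 2 * p j := by
  rw [memLp_two_iff_integrable_sq (measurable_of_countable _).aestronglyMeasurable,
    integrable_lawOf_iff hp]

end Law

theorem momentA_eq {p : ℤ → ℝ} (hp : ∀ j, 0 ≤ p j) (q : ℤ → ℝ) (k : ℕ) :
    momentA p q k = ∑' j, wt p q k j :=
  integral_lawOf hp _

theorem HasMoment.mono {p : ℤ → ℝ} (hp : ∀ j, 0 ≤ p j) {m n : ℕ} (hmn : m ≤ n)
    (h : HasMoment p n) : HasMoment p m := by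
  refine h.of_nonneg_of_le (fun j => mul_nonneg (by positivity) (hp j)) fun j => ?_
  refine mul_le_mul_of_nonneg_right (pow_le_pow_right₀ ?_ hmn) (hp j)
  linarith [abs_nonneg (j : ℝ)]

/-- The order `k` is admissible for `(p, q)` when `p` has a finite moment of order `2k` and
`q^{[k]} p` does not vanish identically, so that `φ_k` and `X_k` make sense. -/
structure IsAdmissible (p q : ℤ → ℝ) (k : ℕ) : Prop where
  hasMoment : HasMoment p (2 * k)
  exists_pos : ∃ j, 0 < wt p q k j

/-- The unnormalized `k`-th Fourier coefficient `∑_j (-1)^k Δ^k[q^{[k]} p](j - k) g(j)` of `g`. -/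
def rodCoef (p q : ℤ → ℝ) (k : ℕ) (g : ℤ → ℝ) : ℝ := ∑' j, backDiff^[k] (wt p q k) j * g j

theorem leadCoef_one (δ : ℝ) (i : ℕ) : leadCoef δ i 1 = 1 - 2 * i * δ := by simp [leadCoef]

theorem leadCoef_zero_left (δ : ℝ) (k : ℕ) : leadCoef δ 0 k = leadC k δ := by
  simp [leadCoef, leadC]

theorem leadC_deltaI {δ : ℝ} {i t : ℕ} (h : t = 0 ∨ 1 - 2 * i * δ ≠ 0) :
    leadC t (deltaI δ i) = leadCoef δ i t / (1 - 2 * i * δ) ^ t := by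
  rcases h with rfl | h
  · simp [leadC, leadCoef]
  · conv_rhs => rw [leadCoef, ← Finset.card_range t, ← Finset.prod_const, Finset.card_range,
      ← Finset.prod_div_distrib]
    refine Finset.prod_congr rfl fun r _ => ?_
    rw [deltaI, eq_div_iff h, sub_mul, mul_assoc _ (δ / _), div_mul_cancel₀ _ h]
    ring

theorem weight_mul_leadCoef (δ : ℝ) (i t : ℕ) :
    weight δ (i + t) i * (t.factorial * leadCoef δ i t) =
      (i + t).factorial * leadCoef δ 0 (i + t) := by
  have hsplit : leadCoef δ 0 (i + t) =
      (∏ r ∈ Finset.range i, (1 - (((i + t : ℕ) : ℝ) - 1 + r) * δ)) * leadCoef δ i t := by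
    rw [leadCoef, leadCoef, Finset.prod_range_add]
    congr 1 <;> refine Finset.prod_congr rfl fun r _ => ?_ <;> push_cast <;> ring
  rw [weight, Nat.add_sub_cancel_left, hsplit, div_mul_eq_mul_div,
    div_eq_iff (Nat.cast_ne_zero.2 t.factorial_ne_zero)]
  ring

theorem ascPow_quadI (q : ℤ → ℝ) (δ : ℝ) (i t : ℕ) (j : ℤ) :
    ascPow (quadI q δ i) t j = ascPow q t (j + i) / (1 - 2 * i * δ) ^ t := by
  simp only [ascPow, quadI, Finset.prod_div_distrib, Finset.prod_const, Finset.card_range,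
    add_right_comm]

theorem wt_pmfI_quadI (p q : ℤ → ℝ) (δ : ℝ) (i t : ℕ) (j : ℤ) :
    wt (pmfI p q i) (quadI q δ i) t j =
      ((1 - 2 * i * δ) ^ t * momentA p q i)⁻¹ * wt p q (i + t) j := by
  rw [wt, ascPow_quadI, pmfI, wt_add, wt, mul_inv]
  ring

theorem stdPoly_mul_self {p q : ℤ → ℝ} (δ : ℝ) {k : ℕ} {j : ℤ}
    (h0 : p j = 0 → backDiff^[k] (wt p q k) j = 0) :
    stdPoly p q δ k j * p j =
      backDiff^[k] (wt p q k) j / √(k.factorial * leadC k δ * momentA p q k) := by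
  have hrod : rodrigues p q k j * p j = backDiff^[k] (wt p q k) j := by
    rw [rodrigues, ← neg_one_pow_mul_diff_sub]
    exact div_mul_cancel_of_imp fun hp => (neg_one_pow_mul_diff_sub ..).trans (h0 hp)
  rw [stdPoly, div_mul_eq_mul_div, hrod]

namespace IsOrdSeq

variable {p q : ℤ → ℝ} {μ δ : ℝ} (H : IsOrdSeq p q μ δ)

include H

theorem momentA_nonneg (k : ℕ) : 0 ≤ momentA p q k := by
  rw [momentA_eq H.nonneg]
  exact tsum_nonneg (H.wt_nonneg k)

theorem pmfI_nonneg (i : ℕ) (j : ℤ) : 0 ≤ pmfI p q i j :=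
  div_nonneg (H.wt_nonneg i j) (H.momentA_nonneg i)

theorem hasSum_iterate_backDiff_wt_mul {i t : ℕ} (hm : HasMoment p (2 * (i + t))) {d : ℝ}
    {f : ℤ → ℝ} (hf : HasLead t d f) :
    HasSum (fun j => backDiff^[t] (wt p q (i + t)) j * f j)
      (t.factorial * d * momentA p q (i + t)) := by
  have hdiff (j : ℤ) : backDiff^[0] (wt p q (i + t)) j * diff t f j =
      t.factorial * d * wt p q (i + t) j := by
    rw [hf.diff_eq, mul_comm]
    rfl
  have hsum := (H.summable_wt hm le_rfl).mul_left (t.factorial * d)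
  have := H.hasSum_iterate_backDiff_mul hm (u := 0) (t := t) (by omega)
    (hsum.congr fun j => (hdiff j).symm)
  rwa [zero_add, tsum_congr hdiff, tsum_mul_left, ← momentA_eq H.nonneg] at this

section Admissible

variable {k : ℕ} (hk : IsAdmissible p q k)

include hk

theorem isAdmissible_of_le {i : ℕ} (hi : i ≤ k) : IsAdmissible p q i :=
  ⟨hk.hasMoment.mono H.nonneg (by omega), hk.exists_pos.imp fun _ => H.wt_pos_of_le hi⟩

theorem hasSum_wt : HasSum (wt p q k) (momentA p q k) :=
  momentA_eq H.nonneg q k ▸ (H.summable_wt hk.hasMoment le_rfl).hasSum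

theorem momentA_pos : 0 < momentA p q k := by
  obtain ⟨j, hj⟩ := hk.exists_pos
  exact momentA_eq H.nonneg q k ▸ (H.hasSum_wt hk).summable.tsum_pos (H.wt_nonneg k) j hj

theorem isPmf_pmfI : IsPmf (pmfI p q k) :=
  ⟨H.pmfI_nonneg k, div_self (H.momentA_pos hk).ne' ▸ (H.hasSum_wt hk).div_const _⟩

theorem memLp_two_lawOf_pmfI_iff (f : ℤ → ℝ) :
    MemLp f 2 (lawOf (pmfI p q k)) ↔ Summable fun j => f j ^ 2 * wt p q k j := by
  have hscale (j : ℤ) : f j ^ 2 * pmfI p q k j = f j ^ 2 * wt p q k j / momentA p q k :=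
    (mul_div_assoc ..).symm
  simp only [memLp_two_lawOf_iff (H.pmfI_nonneg k), hscale,
    summable_div_const_iff (H.momentA_pos hk).ne']

end Admissible

/- Pairing the polynomial `f = (-1)^t Δ^t[w_{i+t}(j - t)] / w_i(j)` with itself gives
`∑ f² w_i = t! L A_{i+t}`, where `L` is its leading coefficient; pairing it with `j^t` shows that it
does not vanish on the support of `w_i`. -/
theorem leadCoef_pos {i t : ℕ} (hk : IsAdmissible p q (i + t)) : 0 < leadCoef δ i t := by
  obtain ⟨f, hf, hfw⟩ := H.exists_iterate_backDiff_wt t i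
  have hA := H.momentA_pos hk
  have hnorm := H.hasSum_iterate_backDiff_wt_mul hk.hasMoment hf
  have hmonomial := H.hasSum_iterate_backDiff_wt_mul hk.hasMoment (HasLead.cast.pow t)
  simp only [hfw] at hnorm hmonomial
  have hterm (j : ℤ) : 0 ≤ f j * wt p q i j * f j := by
    rw [mul_right_comm]
    exact mul_nonneg (mul_self_nonneg _) (H.wt_nonneg i j)
  have hnonneg : 0 ≤ t.factorial * leadCoef δ i t * momentA p q (i + t) :=
    hnorm.nonneg hterm
  have hfac : (0 : ℝ) < t.factorial := by exact_mod_cast t.factorial_pos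
  refine (nonneg_of_mul_nonneg_right (nonneg_of_mul_nonneg_left hnonneg hA) hfac).lt_of_ne'
    fun hzero => ?_
  rw [hzero, mul_zero, zero_mul, hasSum_zero_iff_of_nonneg hterm] at hnorm
  have hvanish (j : ℤ) : f j * wt p q i j = 0 :=
    (mul_eq_zero.1 (congrFun hnorm j)).elim id fun h => by rw [h, zero_mul]
  simp only [hvanish, zero_mul, one_pow, mul_one] at hmonomial
  exact (mul_pos hfac hA).ne (hasSum_zero.unique hmonomial)

theorem one_sub_pos {i : ℕ} (hi : IsAdmissible p q (i + 1)) : 0 < 1 - 2 * i * δ :=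
  leadCoef_one δ i ▸ H.leadCoef_pos hi

theorem momentA_pmfI_quadI (i t : ℕ) :
    momentA (pmfI p q i) (quadI q δ i) t =
      ((1 - 2 * i * δ) ^ t * momentA p q i)⁻¹ * momentA p q (i + t) := by
  rw [momentA_eq (H.pmfI_nonneg i), momentA_eq H.nonneg q (i + t), ← tsum_mul_left]
  simp only [wt_pmfI_quadI]

theorem stdPolyI_mul_pmfI {i t : ℕ} (hk : IsAdmissible p q (i + t)) (j : ℤ) :
    stdPolyI p q δ t i j * pmfI p q i j = backDiff^[t] (wt p q (i + t)) j /
      √(t.factorial * leadCoef δ i t * momentA p q (i + t) * momentA p q i) := by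
  have hA : 0 < momentA p q i := H.momentA_pos (H.isAdmissible_of_le hk (by omega))
  have hδ : t = 0 ∨ 0 < 1 - 2 * i * δ :=
    t.eq_zero_or_pos.imp_right fun ht => H.one_sub_pos (H.isAdmissible_of_le hk (by omega))
  have hD : 0 < (1 - 2 * i * δ) ^ t := by
    rcases hδ with rfl | hδ
    · simp
    · exact pow_pos hδ t
  have hbackDiff : backDiff^[t] (wt (pmfI p q i) (quadI q δ i) t) j =
      ((1 - 2 * i * δ) ^ t * momentA p q i)⁻¹ * backDiff^[t] (wt p q (i + t)) j := by
    rw [funext (wt_pmfI_quadI p q δ i t), iterate_backDiff_const_mul]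
  rw [stdPolyI, stdPoly_mul_self, hbackDiff, leadC_deltaI (hδ.imp_right ne_of_gt),
    H.momentA_pmfI_quadI]
  · generalize (1 - 2 * i * δ) ^ t = D at hD
    have hsqrt : t.factorial * (leadCoef δ i t / D) * ((D * momentA p q i)⁻¹ * momentA p q (i + t))
        = (t.factorial * leadCoef δ i t * momentA p q (i + t) * momentA p q i) /
          (D * momentA p q i) ^ 2 := by
      field_simp
    rw [hsqrt, Real.sqrt_div' _ (sq_nonneg _), Real.sqrt_sq (by positivity)]
    field_simp
  · intro hp
    obtain ⟨f, -, hfw⟩ := H.exists_iterate_backDiff_wt t i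
    have hw : wt p q i j = 0 := (div_eq_zero_iff.1 hp).resolve_right hA.ne'
    simp only [hbackDiff, hfw, hw, mul_zero]

theorem stdPoly_mul_self (k : ℕ) (j : ℤ) :
    stdPoly p q δ k j * p j = backDiff^[k] (wt p q k) j /
      √(k.factorial * leadCoef δ 0 k * momentA p q k) := by
  rw [leadCoef_zero_left, CumOrd.stdPoly_mul_self]
  intro hp
  obtain ⟨f, -, hfw⟩ := H.exists_iterate_backDiff_wt k 0
  rw [zero_add, wt_zero] at hfw
  simp only [hfw, hp, mul_zero]

end IsOrdSeq

theorem summable_mul_mul_of_sq {ι : Type*} {w a f : ι → ℝ} (hw : ∀ j, 0 ≤ w j)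
    (ha : Summable fun j => a j ^ 2 * w j) (hf : Summable fun j => f j ^ 2 * w j) :
    Summable fun j => a j * w j * f j := by
  refine .of_norm_bounded (ha.add hf) fun j => ?_
  rw [mul_right_comm, norm_mul, Real.norm_of_nonneg (hw j), ← add_mul, Real.norm_eq_abs, abs_mul,
    ← sq_abs (a j), ← sq_abs (f j)]
  refine mul_le_mul_of_nonneg_right ?_ (hw j)
  nlinarith [sq_nonneg (|a j| - |f j|), sq_nonneg (|a j| + |f j|)]

namespace IsOrdSeq

variable {p q : ℤ → ℝ} {μ δ : ℝ} (H : IsOrdSeq p q μ δ)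

include H

theorem summable_iterate_backDiff_mul_of_sq {i t : ℕ} (hm : HasMoment p (2 * (i + t))) {f : ℤ → ℝ}
    (hf : Summable fun j => f j ^ 2 * wt p q i j) :
    Summable fun j => backDiff^[t] (wt p q (i + t)) j * f j := by
  obtain ⟨a, ha, haw⟩ := H.exists_iterate_backDiff_wt t i
  simp only [haw]
  have hsq := H.summable_mul_wt (i := i) hm (ha.mul ha) (by omega)
  exact summable_mul_mul_of_sq (H.wt_nonneg i) (hsq.congr fun j => by rw [sq]) hf

theorem hasSum_iterate_backDiff_mul_diff {k m i : ℕ} (hm : HasMoment p (2 * k)) (hi : i ≤ m)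
    (hmk : m ≤ k) {g : ℤ → ℝ} (hg : Summable fun j => diff m g j ^ 2 * wt p q m j) :
    HasSum (fun j => backDiff^[k - i] (wt p q k) j * diff i g j) (rodCoef p q k g) := by
  obtain ⟨t, rfl⟩ := Nat.exists_eq_add_of_le' hi
  obtain ⟨u, rfl⟩ := Nat.exists_eq_add_of_le hmk
  have hdiff : diff (t + i) g = diff t (diff i g) := Function.iterate_add_apply ..
  have hsum := H.summable_iterate_backDiff_mul_of_sq hm hg
  rw [hdiff] at hsum
  have hmid := (H.hasSum_iterate_backDiff_mul hm (by omega) hsum).summable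
  rw [show t + i + u - i = u + t by omega]
  have hfull := (H.hasSum_iterate_backDiff_mul hm (by omega) hmid).tsum_eq
  rw [show u + t + i = t + i + u by omega] at hfull
  exact rodCoef.eq_1 p q _ g ▸ hfull ▸ hmid.hasSum

section Coefficients

variable {k : ℕ} (hk : IsAdmissible p q k)

include hk

theorem hasSum_stdPoly_mul {m : ℕ} (hmk : m ≤ k) {g : ℤ → ℝ}
    (hg : Summable fun j => diff m g j ^ 2 * wt p q m j) :
    HasSum (fun j => stdPoly p q δ k j * g j * p j)
      (rodCoef p q k g / √(k.factorial * leadCoef δ 0 k * momentA p q k)) := by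
  have := (H.hasSum_iterate_backDiff_mul_diff hk.hasMoment m.zero_le hmk hg).div_const
    √(k.factorial * leadCoef δ 0 k * momentA p q k)
  refine this.congr_fun fun j => ?_
  rw [mul_right_comm, H.stdPoly_mul_self, div_mul_eq_mul_div]
  rfl

theorem weight_pos {i : ℕ} (hi : i ≤ k) : 0 < weight δ k i := by
  obtain ⟨t, rfl⟩ := Nat.exists_eq_add_of_le hi
  have hL0 := H.leadCoef_pos (i := 0) (t := i + t) ((zero_add (i + t)).symm ▸ hk)
  have hright : 0 < (i + t).factorial * leadCoef δ 0 (i + t) := by positivity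
  rw [← weight_mul_leadCoef] at hright
  have hL := H.leadCoef_pos hk
  exact pos_of_mul_pos_left hright (by positivity)

theorem coeffV_mul {i : ℕ} (hi : i ≤ k) (b : ℝ) :
    coeffV p q δ k i * (b / √(k.factorial * leadCoef δ 0 k * momentA p q k)) =
      b / √((k - i).factorial * leadCoef δ i (k - i) * momentA p q k * momentA p q i) := by
  obtain ⟨t, rfl⟩ := Nat.exists_eq_add_of_le hi
  have hW := H.weight_pos hk hi
  have hL := H.leadCoef_pos hk
  have hA := H.momentA_pos hk
  rw [Nat.add_sub_cancel_left, coeffV, ← weight_mul_leadCoef, Real.sqrt_div hW.le,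
    mul_assoc (weight ..), Real.sqrt_mul hW.le,
    Real.sqrt_mul (by positivity : 0 ≤ t.factorial * leadCoef δ i t * momentA p q (i + t))]
  have := Real.sqrt_pos.2 hW
  field_simp

theorem hasSum_stdPolyI_mul_diff {m i : ℕ} (hi : i ≤ m) (hmk : m ≤ k) {g : ℤ → ℝ}
    (hg : Summable fun j => diff m g j ^ 2 * wt p q m j) :
    HasSum (fun j => stdPolyI p q δ (k - i) i j * diff i g j * pmfI p q i j)
      (coeffV p q δ k i * ∑' j, stdPoly p q δ k j * g j * p j) := by
  rw [(H.hasSum_stdPoly_mul hk hmk hg).tsum_eq, H.coeffV_mul hk (hi.trans hmk)]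
  have := (H.hasSum_iterate_backDiff_mul_diff hk.hasMoment hi hmk hg).div_const
    √((k - i).factorial * leadCoef δ i (k - i) * momentA p q k * momentA p q i)
  obtain ⟨t, rfl⟩ := Nat.exists_eq_add_of_le (hi.trans hmk)
  rw [Nat.add_sub_cancel_left] at this ⊢
  refine this.congr_fun fun j => ?_
  rw [mul_right_comm, H.stdPolyI_mul_pmfI hk, div_mul_eq_mul_div]

theorem weight_mul_tsum_sq {m i : ℕ} (hik : i ≤ k) (hmk : m ≤ k) {g : ℤ → ℝ}
    (hg : Summable fun j => diff m g j ^ 2 * wt p q m j) :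
    weight δ k i * (∑' j, stdPoly p q δ k j * g j * p j) ^ 2 =
      rodCoef p q k g ^ 2 / ((k - i).factorial * leadCoef δ i (k - i) * momentA p q k) := by
  rw [(H.hasSum_stdPoly_mul hk hmk hg).tsum_eq]
  obtain ⟨t, rfl⟩ := Nat.exists_eq_add_of_le hik
  have hW := H.weight_pos hk hik
  have hL := H.leadCoef_pos hk
  have hA := H.momentA_pos hk
  rw [Nat.add_sub_cancel_left, ← weight_mul_leadCoef, div_pow, Real.sq_sqrt (by positivity)]
  field_simp

end Coefficients

end IsOrdSeq

/-! ### Exponential moments -/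

/-- `p` has a finite exponential moment of rate `ρ`. -/
def HasExpMoment (p : ℤ → ℝ) (ρ : ℝ) : Prop := Summable fun j : ℤ => Real.exp (ρ * |(j : ℝ)|) * p j

theorem exists_pow_le_mul_exp {ε : ℝ} (hε : 0 < ε) (N : ℕ) :
    ∃ K, ∀ x : ℝ, 0 ≤ x → (1 + x) ^ N ≤ K * Real.exp (ε * x) := by
  refine ⟨N.factorial / ε ^ N * Real.exp ε, fun x hx => ?_⟩
  have h := Real.pow_div_factorial_le_exp (x := ε * (1 + x)) (by positivity) N
  rw [div_le_iff₀ (by positivity), mul_pow, mul_one_add, Real.exp_add] at h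
  rw [mul_assoc, div_mul_eq_mul_div, le_div_iff₀ (by positivity)]
  linarith

theorem HasExpMoment.hasMoment_exp_mul {p : ℤ → ℝ} (hp : ∀ j, 0 ≤ p j) {σ ρ : ℝ} (hσ : σ < ρ)
    (h : HasExpMoment p ρ) (N : ℕ) : HasMoment (fun j => Real.exp (σ * |(j : ℝ)|) * p j) N := by
  obtain ⟨K, hK⟩ := exists_pow_le_mul_exp (sub_pos.2 hσ) N
  refine (Summable.mul_left K h).of_nonneg_of_le
    (fun j => mul_nonneg (by positivity) (mul_nonneg (Real.exp_pos _).le (hp j))) fun j => ?_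
  rw [← mul_assoc, ← mul_assoc]
  refine mul_le_mul_of_nonneg_right ?_ (hp j)
  calc (1 + |(j : ℝ)|) ^ N * Real.exp (σ * |(j : ℝ)|)
      ≤ K * Real.exp ((ρ - σ) * |(j : ℝ)|) * Real.exp (σ * |(j : ℝ)|) := by
        gcongr
        exact hK _ (abs_nonneg _)
    _ = K * Real.exp (ρ * |(j : ℝ)|) := by
        rw [mul_assoc, ← Real.exp_add, sub_mul, sub_add_cancel]

theorem HasExpMoment.hasMoment {p : ℤ → ℝ} (hp : ∀ j, 0 ≤ p j) {ρ : ℝ} (hρ : 0 < ρ)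
    (h : HasExpMoment p ρ) (N : ℕ) : HasMoment p N := by
  simpa using h.hasMoment_exp_mul hp hρ N

theorem summable_exp_mul_of_ratio {a : ℕ → ℝ} (ha : ∀ n, 0 ≤ a n) {θ ρ : ℝ}
    (hθρ : θ * Real.exp ρ < 1) (h : ∀ᶠ n in atTop, a (n + 1) ≤ θ * a n) :
    Summable fun n : ℕ => Real.exp (ρ * n) * a n := by
  refine summable_of_ratio_norm_eventually_le hθρ (h.mono fun n hn => ?_)
  rw [Real.norm_of_nonneg (mul_nonneg (Real.exp_pos _).le (ha _)),
    Real.norm_of_nonneg (mul_nonneg (Real.exp_pos _).le (ha _)), Nat.cast_succ, mul_add_one,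
    Real.exp_add]
  calc Real.exp (ρ * n) * Real.exp ρ * a (n + 1)
      ≤ Real.exp (ρ * n) * Real.exp ρ * (θ * a n) := by gcongr
    _ = θ * Real.exp ρ * (Real.exp (ρ * n) * a n) := by ring

theorem exists_hasExpMoment_of_ratio {a : ℤ → ℝ} (ha : ∀ j, 0 ≤ a j) {θ : ℝ} (hθ : 0 < θ)
    (hθ1 : θ < 1) (htop : ∀ᶠ j in atTop, a (j + 1) ≤ θ * a j)
    (hbot : ∀ᶠ j in atBot, a (j - 1) ≤ θ * a j) : ∃ ρ > 0, HasExpMoment a ρ := by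
  have hlog : Real.log θ < 0 := Real.log_neg hθ hθ1
  have hθρ : θ * Real.exp (-Real.log θ / 2) < 1 := by
    nth_rw 1 [← Real.exp_log hθ]
    rw [← Real.exp_add, Real.exp_lt_one_iff]
    linarith
  refine ⟨-Real.log θ / 2, by linarith, Summable.of_nat_of_neg ?_ ?_⟩
  · simpa using summable_exp_mul_of_ratio (a := fun n : ℕ => a n) (fun n => ha n) hθρ
      (by simpa using tendsto_natCast_atTop_atTop.eventually htop)
  · have hneg : Tendsto (fun n : ℕ => -(n : ℤ)) atTop atBot :=
      tendsto_neg_atTop_atBot.comp tendsto_natCast_atTop_atTop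
    simpa using summable_exp_mul_of_ratio (a := fun n : ℕ => a (-n)) (fun n => ha _) hθρ
      (by simpa [neg_add, sub_eq_add_neg, add_comm] using hneg.eventually hbot)

theorem HasLead.exists_le_mul_abs_sub {δ : ℝ} (hδ : δ ≤ 0) {q : ℤ → ℝ} (hq : HasLead 2 δ q)
    (μ : ℝ) : ∃ K ≥ 1, ∀ j : ℤ, 1 ≤ |(j : ℝ) - μ| → q j ≤ K * |(j : ℝ) - μ| := by
  obtain ⟨β, γ, rfl⟩ := hq.exists_eq_quad
  refine ⟨|β| + |β * μ + γ| + 1, by linarith [abs_nonneg β, abs_nonneg (β * μ + γ)], fun j hj => ?_⟩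
  have hlin : β * (j - μ) ≤ |β| * |(j : ℝ) - μ| := abs_mul β _ ▸ le_abs_self _
  have hconst : β * μ + γ ≤ |β * μ + γ| * |(j : ℝ) - μ| :=
    (le_abs_self _).trans (le_mul_of_one_le_right (abs_nonneg _) hj)
  have hsq : δ * (j : ℝ) ^ 2 ≤ 0 := mul_nonpos_of_nonpos_of_nonneg hδ (sq_nonneg _)
  rw [quad]
  linarith

namespace IsOrdSeq

variable {p q : ℤ → ℝ} {μ δ : ℝ} (H : IsOrdSeq p q μ δ)

include H

theorem le_flux_pred {j : ℤ} (hj : μ + 1 ≤ j) : p j ≤ q (j - 1) * p (j - 1) := by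
  have := mul_nonneg (by linarith : 0 ≤ j - μ - 1) (H.nonneg j)
  linarith [H.flux_sub j, H.flux_nonneg j]

theorem le_flux {j : ℤ} (hj : (j : ℝ) ≤ μ - 1) : p j ≤ q j * p j := by
  have := mul_nonneg (by linarith : 0 ≤ μ - j - 1) (H.nonneg j)
  linarith [H.flux_sub j, H.flux_nonneg (j - 1)]

section Ratio

variable {K : ℝ} (hK1 : 1 ≤ K) (hK : ∀ j : ℤ, 1 ≤ |(j : ℝ) - μ| → q j ≤ K * |(j : ℝ) - μ|)

include hK1 hK

theorem flux_le_mul_flux_pred {j : ℤ} (hj : μ + 1 ≤ j) :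
    q j * p j ≤ K / (1 + K) * (q (j - 1) * p (j - 1)) := by
  have habs : |(j : ℝ) - μ| = j - μ := abs_of_nonneg (by linarith)
  have hle := mul_le_mul_of_nonneg_right (hK j (by rw [habs]; linarith)) (H.nonneg j)
  rw [habs] at hle
  rw [div_mul_eq_mul_div, le_div_iff₀ (by positivity)]
  linear_combination hle + K * H.flux_sub j

theorem flux_pred_le_mul_flux {j : ℤ} (hj : (j : ℝ) ≤ μ - 1) :
    q (j - 1) * p (j - 1) ≤ K / (1 + K) * (q j * p j) := by
  have habs : |(j : ℝ) - μ| = μ - j := by rw [abs_sub_comm, abs_of_nonneg (by linarith)]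
  have hle := mul_le_mul_of_nonneg_right (hK j (by rw [habs]; linarith)) (H.nonneg j)
  rw [habs] at hle
  have hpred : K * (q (j - 1) * p (j - 1)) ≤ (K - 1) * (q j * p j) := by
    linear_combination hle - K * H.flux_sub j
  rw [div_mul_eq_mul_div, le_div_iff₀ (by positivity)]
  refine le_of_mul_le_mul_left ?_ (by positivity : 0 < K)
  nlinarith [H.flux_nonneg j]

end Ratio

theorem exists_hasExpMoment (hδ : δ ≤ 0) : ∃ ρ > 0, HasExpMoment p ρ := by
  obtain ⟨K, hK1, hK⟩ := H.hasLead.exists_le_mul_abs_sub hδ μ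
  have htop : ∀ᶠ j : ℤ in atTop, μ + 1 ≤ j :=
    tendsto_intCast_atTop_atTop.eventually (eventually_ge_atTop _)
  have hbot : ∀ᶠ j : ℤ in atBot, (j : ℝ) ≤ μ - 1 :=
    (tendsto_intCast_atBot_iff.2 tendsto_id).eventually (eventually_le_atBot _)
  set b : ℤ → ℝ := fun j => q j * p j + q (j - 1) * p (j - 1) with hb
  have hb0 (j : ℤ) : 0 ≤ b j := add_nonneg (H.flux_nonneg _) (H.flux_nonneg _)
  have hpb : ∀ᶠ j in cofinite, p j ≤ b j := by
    rw [Int.cofinite_eq, eventually_sup]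
    exact ⟨hbot.mono fun j hj => (H.le_flux hj).trans (le_add_of_nonneg_right (H.flux_nonneg _)),
      htop.mono fun j hj => (H.le_flux_pred hj).trans (le_add_of_nonneg_left (H.flux_nonneg _))⟩
  obtain ⟨ρ, hρ, hexp⟩ := exists_hasExpMoment_of_ratio hb0 (θ := K / (1 + K)) (by positivity)
    ((div_lt_one (by positivity)).2 (by linarith))
    (htop.mono fun j hj => by
      have h := H.flux_le_mul_flux_pred hK1 hK hj
      have h' := H.flux_le_mul_flux_pred hK1 hK (j := j + 1) (by push_cast; linarith)
      rw [add_sub_cancel_right] at h'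
      simp only [hb, mul_add, add_sub_cancel_right]
      exact add_le_add h' h)
    (hbot.mono fun j hj => by
      have h := H.flux_pred_le_mul_flux hK1 hK hj
      have h' := H.flux_pred_le_mul_flux hK1 hK (j := j - 1) (by push_cast; linarith)
      simp only [hb, mul_add]
      exact add_le_add h h')
  refine ⟨ρ, hρ, Summable.of_norm_bounded_eventually hexp (hpb.mono fun j hj => ?_)⟩
  rw [norm_mul, Real.norm_of_nonneg (Real.exp_pos _).le, Real.norm_of_nonneg (H.nonneg j)]
  gcongr

end IsOrdSeq

/-! ### A Poincaré inequality -/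

theorem exists_antidiff (a : ℤ → ℝ) : ∃ S : ℤ → ℝ, S 0 = 0 ∧ ∀ j, S (j + 1) - S j = a j := by
  let S : ℤ → ℝ
    | Int.ofNat n => ∑ r ∈ Finset.range n, a r
    | Int.negSucc n => -∑ r ∈ Finset.range (n + 1), a (Int.negSucc r)
  refine ⟨S, Finset.sum_range_zero _, fun j => ?_⟩
  rcases j with n | _ | n
  · exact (Finset.sum_range_succ_sub_sum fun r : ℕ => a r)
  · change (0 : ℝ) - -(∑ r ∈ Finset.range 1, _) = _
    simp
  · change -(∑ r ∈ Finset.range (n + 1), _) - -(∑ r ∈ Finset.range (n + 1 + 1), _) = _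
    rw [Finset.sum_range_succ _ (n + 1)]
    ring

theorem sq_sub_le_mul_sub {h S : ℤ → ℝ} (hS : ∀ j, S (j + 1) - S j = (h (j + 1) - h j) ^ 2)
    (x y : ℤ) : (h y - h x) ^ 2 ≤ (y - x) * (S y - S x) := by
  wlog hxy : x ≤ y generalizing x y
  · linarith [this y x (le_of_not_ge hxy)]
  obtain ⟨n, rfl⟩ := Int.le.dest hxy
  have htelescope (f : ℤ → ℝ) :
      f (x + n) - f x = ∑ r ∈ Finset.range n, (f (x + r + 1) - f (x + r)) := by
    simpa [add_assoc] using (Finset.sum_range_sub (fun r : ℕ => f (x + r)) n).symm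
  have := sq_sum_le_card_mul_sum_sq (s := Finset.range n)
    (f := fun r => h (x + r + 1) - h (x + r))
  simp only [htelescope, hS]
  simpa using this

theorem summable_sq_mul_of_sub {ι : Type*} {w h : ι → ℝ} (hw : ∀ j, 0 ≤ w j) (hws : Summable w)
    {c : ℝ} (hh : Summable fun j => (h j - c) ^ 2 * w j) : Summable fun j => h j ^ 2 * w j := by
  refine ((hh.mul_left 2).add (hws.mul_left (2 * c ^ 2))).of_nonneg_of_le
    (fun j => mul_nonneg (sq_nonneg _) (hw j)) fun j => ?_
  rw [← mul_assoc, ← add_mul]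
  refine mul_le_mul_of_nonneg_right ?_ (hw j)
  nlinarith [sq_nonneg (h j - 2 * c)]

theorem HasLead.exists_eventually_abs_le {d : ℝ} (hd : d ≠ 0) {f : ℤ → ℝ} (hf : HasLead 1 d f) :
    ∃ K, ∀ᶠ j : ℤ in cofinite, |(j : ℝ)| ≤ K * |f j| := by
  obtain ⟨b, hb⟩ := hf.exists_eq_linear
  have hlarge : ∀ᶠ j : ℤ in cofinite, 2 * |b| / |d| ≤ |(j : ℝ)| := by
    rw [Int.cofinite_eq, eventually_sup]
    exact ⟨(tendsto_abs_atBot_atTop.comp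
        (tendsto_intCast_atBot_iff.2 tendsto_id)).eventually_ge_atTop _,
      (tendsto_abs_atTop_atTop.comp tendsto_intCast_atTop_atTop).eventually_ge_atTop _⟩
  refine ⟨2 / |d|, hlarge.mono fun j hj => ?_⟩
  have hd := abs_pos.2 hd
  rw [div_le_iff₀ hd] at hj
  rw [div_mul_eq_mul_div, le_div_iff₀ hd, hb]
  have := abs_sub_abs_le_abs_sub (d * j) (-b)
  rw [abs_neg, sub_neg_eq_add, abs_mul] at this
  linarith

namespace IsOrdSeq

variable {p q : ℤ → ℝ} {μ δ : ℝ} (H : IsOrdSeq p q μ δ)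

include H

/- Let `S` have the differences `(Δh)²` and vanish at `0`. Summation by parts turns
`∑ (Δh)² w_{i+1}` into `∑ f S w_i` with a linear `f`, and `j S(j) ≥ (h(j) - h(0))²` by
Cauchy–Schwarz. -/
theorem summable_sq_mul_wt_of_fwdDiff {i : ℕ} (hi : IsAdmissible p q (i + 1)) {h : ℤ → ℝ}
    (hs : Summable fun j => fwdDiff 1 h j ^ 2 * wt p q (i + 1) j) :
    Summable fun j => h j ^ 2 * wt p q i j := by
  obtain ⟨S, hS0, hS⟩ := exists_antidiff fun j => (h (j + 1) - h j) ^ 2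
  obtain ⟨f, hf, hfw⟩ := H.exists_iterate_backDiff_wt 1 i
  rw [leadCoef_one] at hf
  obtain ⟨K, hK⟩ := hf.exists_eventually_abs_le (H.one_sub_pos hi).ne'
  have hparts : Summable fun j => f j * wt p q i j * S j := by
    have hcomm (j : ℤ) : fwdDiff 1 h j ^ 2 * wt p q (i + 1) j =
        backDiff^[0] (wt p q (i + 1)) j * fwdDiff 1 S j :=
      (congrArg (· * _) (hS j).symm).trans (mul_comm ..)
    have := H.hasSum_iterate_backDiff_succ_mul hi.hasMoment i.succ_pos (hs.congr hcomm)
    rw [hfw] at this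
    exact this.summable
  have hbase : Summable fun j => (h j - h 0) ^ 2 * wt p q i j := by
    refine .of_norm_bounded_eventually (hparts.abs.mul_left K) (hK.mono fun j hj => ?_)
    have hcauchy := sq_sub_le_mul_sub hS 0 j
    rw [hS0, Int.cast_zero, sub_zero, sub_zero] at hcauchy
    rw [Real.norm_of_nonneg (mul_nonneg (sq_nonneg _) (H.wt_nonneg i j)), abs_mul, abs_mul,
      abs_of_nonneg (H.wt_nonneg i j)]
    calc (h j - h 0) ^ 2 * wt p q i j ≤ |(j : ℝ)| * |S j| * wt p q i j := by
          rw [← abs_mul]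
          gcongr
          · exact H.wt_nonneg i j
          · exact hcauchy.trans (le_abs_self _)
      _ ≤ K * |f j| * |S j| * wt p q i j := by
          gcongr
          exact H.wt_nonneg i j
      _ = K * (|f j| * wt p q i j * |S j|) := by ring
  exact summable_sq_mul_of_sub (H.wt_nonneg i) (H.summable_wt hi.hasMoment (by omega)) hbase

theorem summable_diff_sq_mul_wt {n : ℕ} (hn : IsAdmissible p q n) {g : ℤ → ℝ}
    (hg : Summable fun j => diff n g j ^ 2 * wt p q n j) {i : ℕ} (hi : i ≤ n) :
    Summable fun j => diff i g j ^ 2 * wt p q i j := by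
  induction hi using Nat.decreasingInduction with
  | self => exact hg
  | of_succ i hi ih =>
    refine H.summable_sq_mul_wt_of_fwdDiff (H.isAdmissible_of_le hn hi) (ih.congr fun j => ?_)
    rw [diff, Function.iterate_succ_apply']
    rfl

end IsOrdSeq

/-! ### Determinacy of moments and completeness -/

section Determinacy

open ProbabilityTheory

variable {Ω Ω' : Type*} [MeasurableSpace Ω] [MeasurableSpace Ω'] {μ : Measure Ω} {ν : Measure Ω'}
  {X : Ω → ℝ} {Y : Ω' → ℝ}

theorem complexMGF_eventuallyEq_of_moments (hX : 0 ∈ interior (integrableExpSet X μ))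
    (hY : 0 ∈ interior (integrableExpSet Y ν)) (h : ∀ n : ℕ, ∫ ω, X ω ^ n ∂μ = ∫ ω, Y ω ^ n ∂ν) :
    complexMGF X μ =ᶠ[𝓝 0] complexMGF Y ν := by
  have hderiv (n : ℕ) :
      iteratedDeriv n (complexMGF X μ) 0 = iteratedDeriv n (complexMGF Y ν) 0 := by
    rw [iteratedDeriv_complexMGF (by simpa using hX), iteratedDeriv_complexMGF (by simpa using hY)]
    simp only [zero_mul, Complex.exp_zero, mul_one, ← Complex.ofReal_pow]
    rw [integral_complex_ofReal, integral_complex_ofReal, h n]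
  have hseriesX := (analyticAt_complexMGF (z := 0) (by simpa using hX)).hasFPowerSeriesAt
  have hseriesY := (analyticAt_complexMGF (z := 0) (by simpa using hY)).hasFPowerSeriesAt
  simp only [hderiv] at hseriesX
  filter_upwards [hseriesX.eventually_hasSum_sub, hseriesY.eventually_hasSum_sub] with z hzX hzY
    using hzX.unique hzY

theorem map_eq_map_of_moments [IsFiniteMeasure μ] [IsFiniteMeasure ν] (hXm : AEMeasurable X μ)
    (hYm : AEMeasurable Y ν) (hX : 0 ∈ interior (integrableExpSet X μ))
    (hY : 0 ∈ interior (integrableExpSet Y ν)) (h : ∀ n : ℕ, ∫ ω, X ω ^ n ∂μ = ∫ ω, Y ω ^ n ∂ν) :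
    μ.map X = ν.map Y := by
  let S : Set ℝ := interior (integrableExpSet X μ) ∩ interior (integrableExpSet Y ν)
  have hconvex : Convex ℝ S :=
    convex_integrableExpSet.interior.inter convex_integrableExpSet.interior
  have hstrip : IsPreconnected (Complex.re ⁻¹' S) :=
    (hconvex.linear_preimage Complex.reLm).isPreconnected
  have heq : Set.EqOn (complexMGF X μ) (complexMGF Y ν) (Complex.re ⁻¹' S) :=
    (analyticOnNhd_complexMGF.mono fun z hz => hz.1).eqOn_of_preconnected_of_eventuallyEq
      (analyticOnNhd_complexMGF.mono fun z hz => hz.2) hstrip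
      (show (0 : ℂ).re ∈ S from ⟨hX, hY⟩) (complexMGF_eventuallyEq_of_moments hX hY h)
  refine Measure.ext_of_charFun (funext fun t => ?_)
  rw [← complexMGF_mul_I hXm, ← complexMGF_mul_I hYm]
  exact heq (show (t * Complex.I).re ∈ S by simpa using ⟨hX, hY⟩)

theorem isFiniteMeasure_lawOf {p : ℤ → ℝ} (hp : ∀ j, 0 ≤ p j) (hs : Summable p) :
    IsFiniteMeasure (lawOf p) :=
  (integrable_const_iff.1 ((integrable_lawOf_iff hp fun _ => 1).2 (by simpa using hs))).resolve_left
    one_ne_zero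

theorem HasExpMoment.zero_mem_interior_integrableExpSet {p : ℤ → ℝ} (hp : ∀ j, 0 ≤ p j) {ρ : ℝ}
    (hρ : 0 < ρ) (h : HasExpMoment p ρ) :
    0 ∈ interior (integrableExpSet (fun j : ℤ => (j : ℝ)) (lawOf p)) := by
  rw [mem_interior_iff_mem_nhds]
  filter_upwards [Metric.ball_mem_nhds (0 : ℝ) hρ] with t ht
  refine (integrable_lawOf_iff hp _).2 (h.of_nonneg_of_le
    (fun j => mul_nonneg (Real.exp_pos _).le (hp j)) fun j => ?_)
  refine mul_le_mul_of_nonneg_right (Real.exp_le_exp.2 ((le_abs_self _).trans ?_)) (hp j)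
  rw [abs_mul]
  gcongr
  simpa using (Metric.mem_ball.1 ht).le

theorem lawOf_singleton (p : ℤ → ℝ) (j : ℤ) : lawOf p {j} = ENNReal.ofReal (p j) := by
  simp [lawOf]

theorem eq_of_moments {u v : ℤ → ℝ} (hu : ∀ j, 0 ≤ u j) (hv : ∀ j, 0 ≤ v j) {ρ : ℝ} (hρ : 0 < ρ)
    (hue : HasExpMoment u ρ) (hve : HasExpMoment v ρ)
    (h : ∀ n : ℕ, ∑' j : ℤ, (j : ℝ) ^ n * u j = ∑' j : ℤ, (j : ℝ) ^ n * v j) : u = v := by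
  have := isFiniteMeasure_lawOf hu (by simpa [HasMoment] using hue.hasMoment hu hρ 0)
  have := isFiniteMeasure_lawOf hv (by simpa [HasMoment] using hve.hasMoment hv hρ 0)
  have hcast : MeasurableEmbedding (fun j : ℤ => (j : ℝ)) :=
    Int.isClosedEmbedding_coe_real.measurableEmbedding
  have hmap : (lawOf u).map (fun j : ℤ => (j : ℝ)) = (lawOf v).map fun j : ℤ => (j : ℝ) := by
    refine map_eq_map_of_moments hcast.measurable.aemeasurable hcast.measurable.aemeasurable
      (hue.zero_mem_interior_integrableExpSet hu hρ)
      (hve.zero_mem_interior_integrableExpSet hv hρ) fun n => ?_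
    rw [integral_lawOf hu, integral_lawOf hv, h]
  funext j
  have := congrArg (fun m => m ((fun j : ℤ => (j : ℝ)) '' {j})) hmap
  simp only [hcast.map_apply, Set.preimage_image_eq _ hcast.injective, lawOf_singleton] at this
  exact (ENNReal.ofReal_eq_ofReal_iff (hu j) (hv j)).1 this

end Determinacy

theorem HasExpMoment.mono {u v : ℤ → ℝ} (hu : ∀ j, 0 ≤ u j) (huv : ∀ j, u j ≤ v j) {ρ : ℝ}
    (h : HasExpMoment v ρ) : HasExpMoment u ρ :=
  h.of_nonneg_of_le (fun j => mul_nonneg (Real.exp_pos _).le (hu j)) fun j =>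
    mul_le_mul_of_nonneg_left (huv j) (Real.exp_pos _).le

theorem eq_zero_of_moments {u : ℤ → ℝ} {ρ : ℝ} (hρ : 0 < ρ) (hu : HasExpMoment |u| ρ)
    (h : ∀ n : ℕ, ∑' j : ℤ, (j : ℝ) ^ n * u j = 0) : u = 0 := by
  have hpos : HasExpMoment u⁺ ρ :=
    hu.mono (posPart_nonneg u) (Pi.le_def.1 (sup_le (le_abs_self u) (abs_nonneg u)))
  have hneg : HasExpMoment u⁻ ρ :=
    hu.mono (negPart_nonneg u) (Pi.le_def.1 (sup_le (neg_le_abs u) (abs_nonneg u)))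
  have hsummable {v : ℤ → ℝ} (hv : 0 ≤ v) (hve : HasExpMoment v ρ) (n : ℕ) :
      Summable fun j : ℤ => (j : ℝ) ^ n * v j :=
    (hve.hasMoment hv hρ n).summable_mul hv (HasLead.cast.pow n) le_rfl
  have heq : u⁺ = u⁻ := by
    refine eq_of_moments (posPart_nonneg u) (negPart_nonneg u) hρ hpos hneg fun n => ?_
    rw [← sub_eq_zero, ← (hsummable (posPart_nonneg u) hpos n).tsum_sub
      (hsummable (negPart_nonneg u) hneg n), ← h n]
    refine tsum_congr fun j => ?_
    rw [← mul_sub, ← Pi.sub_apply, posPart_sub_negPart]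
  rw [← posPart_sub_negPart u, heq, sub_self]

theorem moments_eq_zero_of_forall_hasLead {u : ℤ → ℝ}
    (hu : ∀ n : ℕ, Summable fun j : ℤ => (j : ℝ) ^ n * u j)
    (h : ∀ n, ∃ c ≠ 0, ∃ f, HasLead n c f ∧ ∑' j, f j * u j = 0) (n : ℕ) :
    ∑' j : ℤ, (j : ℝ) ^ n * u j = 0 := by
  induction n using Nat.strong_induction_on with
  | _ n ih =>
    obtain ⟨c, hc, f, ⟨P, hdeg, hlead, hP⟩, hzero⟩ := h n
    have hexpand (j : ℤ) :
        f j * u j = ∑ m ∈ Finset.range (n + 1), P.coeff m * ((j : ℝ) ^ m * u j) := by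
      simp only [hP, P.eval_eq_sum_range' (Nat.lt_succ_of_le hdeg), Finset.sum_mul, mul_assoc]
    rw [tsum_congr hexpand, Summable.tsum_finsetSum fun m _ => (hu m).mul_left _] at hzero
    simp only [tsum_mul_left] at hzero
    rw [Finset.sum_range_succ, Finset.sum_eq_zero fun m hm => by
      rw [ih m (Finset.mem_range.1 hm), mul_zero], zero_add, hlead] at hzero
    exact (mul_eq_zero.1 hzero).resolve_left hc

namespace IsOrdSeq

variable {p q : ℤ → ℝ} {μ δ : ℝ} (H : IsOrdSeq p q μ δ)

include H

theorem pos_of_le_of_le {a b j : ℤ} (ha : 0 < p a) (hb : 0 < p b) (haj : a ≤ j) (hjb : j ≤ b) :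
    0 < p j := by
  rcases hjb.eq_or_lt with rfl | hjb
  · exact hb
  · exact (H.nonneg j).lt_of_ne' (right_ne_zero_of_mul (H.flux_pos ha hb haj hjb).ne')

theorem lt_add_of_wt_pos {i t : ℕ} (ht : ¬∃ j, 0 < wt p q (i + t) j) {a b : ℤ}
    (ha : 0 < wt p q i a) (hb : 0 < wt p q i b) : b < a + t := by
  by_contra! hab
  have hpa := (H.wt_pos_iff.1 ha).1
  have hpb := (H.wt_pos_iff.1 hb).2
  exact ht ⟨a, H.wt_pos_iff.2 ⟨hpa, H.pos_of_le_of_le hpa hpb (by omega) (by push_cast; omega)⟩⟩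

theorem exists_hasLead_mul_wt_eq_zero {i t : ℕ} (ht : ¬∃ j, 0 < wt p q (i + t) j) :
    ∃ f, HasLead t 1 f ∧ ∀ j, f j * wt p q i j = 0 := by
  by_cases hne : ∃ j, 0 < wt p q i j
  · obtain ⟨b, hb⟩ := hne
    obtain ⟨a, ha, hleast⟩ := Int.exists_least_of_bdd (P := fun z => 0 < wt p q i z)
      ⟨b - t, fun z hz => by linarith [H.lt_add_of_wt_pos ht hz hb]⟩ ⟨b, hb⟩
    have hlead := (HasLead.cast.ascPow t).shift (-(a + t - 1))
    rw [one_mul, one_pow] at hlead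
    refine ⟨_, hlead, fun j => ?_⟩
    by_cases hj : wt p q i j = 0
    · rw [hj, mul_zero]
    · have hj := (H.wt_nonneg i j).lt_of_ne' hj
      have haj := hleast j hj
      have hjt := H.lt_add_of_wt_pos ht ha hj
      refine mul_eq_zero_of_left (Finset.prod_eq_zero (i := (a + t - 1 - j).toNat)
        (Finset.mem_range.2 (by omega)) ?_) _
      rw [Int.toNat_of_nonneg (by omega)]
      push_cast
      ring
  · push Not at hne
    refine ⟨_, one_pow (M := ℝ) t ▸ HasLead.cast.pow t, fun j => ?_⟩
    rw [(hne j).antisymm (H.wt_nonneg i j), mul_zero]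

theorem hasExpMoment_abs_wt_mul {ρ σ : ℝ} (hσ : 2 * σ < ρ) (hexp : HasExpMoment p ρ) {i : ℕ}
    {h : ℤ → ℝ} (hh : Summable fun j => h j ^ 2 * wt p q i j) :
    HasExpMoment |wt p q i * h| σ := by
  have hexp_sq : Summable fun j : ℤ => Real.exp (σ * |(j : ℝ)|) ^ 2 * wt p q i j := by
    have := (hexp.hasMoment_exp_mul H.nonneg hσ (2 * i)).summable_mul
      (fun j => mul_nonneg (Real.exp_pos _).le (H.nonneg j)) (H.hasLead.ascPow i) le_rfl
    refine this.congr fun j => ?_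
    rw [← Real.exp_nat_mul, wt]
    push_cast
    ring_nf
  refine (summable_mul_mul_of_sq (H.wt_nonneg i) hexp_sq hh).abs.congr fun j => ?_
  rw [mul_assoc, abs_mul, abs_of_pos (Real.exp_pos _)]
  rfl

/- Where `w_{i+t}` vanishes identically, the support of `w_i` has at most `t` points, and the nodal
polynomial of these points takes over the role of `(-1)^t Δ^t[w_{i+t}(j - t)] / w_i(j)`. -/
theorem mul_wt_eq_zero_of_orthogonal {ρ : ℝ} (hρ : 0 < ρ) (hexp : HasExpMoment p ρ) {i : ℕ}
    {h : ℤ → ℝ} (hh : Summable fun j => h j ^ 2 * wt p q i j)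
    (horth : ∀ t, (∃ j, 0 < wt p q (i + t) j) →
      ∑' j, backDiff^[t] (wt p q (i + t)) j * h j = 0) : wt p q i * h = 0 := by
  have hdecay : HasExpMoment |wt p q i * h| (ρ / 3) :=
    H.hasExpMoment_abs_wt_mul (by linarith) hexp hh
  have hmom (N : ℕ) : HasMoment p N := hexp.hasMoment H.nonneg hρ N
  refine eq_zero_of_moments (by positivity) hdecay
    (moments_eq_zero_of_forall_hasLead (fun n => ?_) fun t => ?_)
  · have := (hdecay.hasMoment (fun j => abs_nonneg _) (by positivity) n).summable_mul
      (fun j => abs_nonneg _) (HasLead.cast.pow n) le_rfl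
    exact this.norm.of_norm_bounded fun j => by simp [abs_mul]
  · by_cases ht : ∃ j, 0 < wt p q (i + t) j
    · obtain ⟨f, hf, hfw⟩ := H.exists_iterate_backDiff_wt t i
      refine ⟨_, (H.leadCoef_pos ⟨hmom _, ht⟩).ne', f, hf, ?_⟩
      simpa [hfw, mul_assoc] using horth t ht
    · obtain ⟨f, hf, hfw⟩ := H.exists_hasLead_mul_wt_eq_zero ht
      exact ⟨1, one_ne_zero, f, hf, by simp [← mul_assoc, hfw]⟩

end IsOrdSeq

/-! ### Parseval's identity -/

theorem hasSum_inner_sq_div_of_orthogonal {ι E : Type*} [NormedAddCommGroup E]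
    [InnerProductSpace ℝ E] [CompleteSpace E] {v : ι → E} (hv : ∀ k, v k ≠ 0)
    (horth : Pairwise fun k l => inner ℝ (v k) (v l) = 0)
    (hcomplete : ∀ x, (∀ k, inner ℝ (v k) x = 0) → x = 0) (x : E) :
    HasSum (fun k => inner ℝ (v k) x ^ 2 / ‖v k‖ ^ 2) (‖x‖ ^ 2) := by
  let e (k : ι) : E := ‖v k‖⁻¹ • v k
  have he : Orthonormal ℝ e := by
    refine ⟨fun k => norm_smul_inv_norm (hv k), fun k l hkl => ?_⟩
    simp only [e, real_inner_smul_left, real_inner_smul_right, horth hkl, mul_zero]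
  have hbot : (Submodule.span ℝ (Set.range e))ᗮ = ⊥ := by
    refine (Submodule.eq_bot_iff _).2 fun y hy => hcomplete y fun k => ?_
    have := (Submodule.mem_orthogonal _ y).1 hy (e k) (Submodule.subset_span ⟨k, rfl⟩)
    rw [real_inner_smul_left] at this
    exact (mul_eq_zero.1 this).resolve_left (inv_ne_zero (norm_ne_zero_iff.2 (hv k)))
  have hsum := (HilbertBasis.mkOfOrthogonalEqBot he hbot).hasSum_inner_mul_inner x x
  rw [HilbertBasis.coe_mkOfOrthogonalEqBot, real_inner_self_eq_norm_sq] at hsum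
  refine hsum.congr_fun fun k => ?_
  rw [real_inner_comm (e k), real_inner_smul_left]
  ring

section Law

variable {w : ℤ → ℝ} (hw : ∀ j, 0 ≤ w j)

include hw

theorem inner_lawOf (f g : Lp ℝ 2 (lawOf w)) : inner ℝ f g = ∑' j, f j * g j * w j := by
  rw [L2.inner_def, ← integral_lawOf hw]
  simp [mul_comm]

theorem inner_toLp_lawOf {f g : ℤ → ℝ} (hf : MemLp f 2 (lawOf w)) (hg : MemLp g 2 (lawOf w)) :
    inner ℝ (hf.toLp f) (hg.toLp g) = ∑' j, f j * g j * w j := by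
  rw [L2.inner_def, ← integral_lawOf hw]
  refine integral_congr_ae ?_
  filter_upwards [hf.coeFn_toLp, hg.coeFn_toLp] with j hfj hgj
  simp [hfj, hgj, mul_comm]

theorem hasSum_sq_div_of_orthogonal {ι : Type*} {ψ : ι → ℤ → ℝ} {c : ι → ℝ} (hc : ∀ k, 0 < c k)
    (hψ : ∀ k, HasSum (fun j => ψ k j ^ 2 * w j) (c k))
    (horth : Pairwise fun k l => ∑' j, ψ k j * ψ l j * w j = 0)
    (hcomplete : ∀ f : ℤ → ℝ, (Summable fun j => f j ^ 2 * w j) →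
      (∀ k, ∑' j, ψ k j * f j * w j = 0) → w * f = 0)
    {f : ℤ → ℝ} (hf : Summable fun j => f j ^ 2 * w j) :
    HasSum (fun k => (∑' j, ψ k j * f j * w j) ^ 2 / c k) (∑' j, f j ^ 2 * w j) := by
  have hmem (k : ι) : MemLp (ψ k) 2 (lawOf w) := (memLp_two_lawOf_iff hw _).2 (hψ k).summable
  have hf := (memLp_two_lawOf_iff hw f).2 hf
  let v (k : ι) : Lp ℝ 2 (lawOf w) := (hmem k).toLp (ψ k)
  have hnorm {g : ℤ → ℝ} (hg : MemLp g 2 (lawOf w)) : ‖hg.toLp g‖ ^ 2 = ∑' j, g j ^ 2 * w j := by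
    rw [← real_inner_self_eq_norm_sq, inner_toLp_lawOf hw]
    simp only [sq]
  have hnormv (k : ι) : ‖v k‖ ^ 2 = c k := (hnorm (hmem k)).trans (hψ k).tsum_eq
  have hinner (k : ι) {g : ℤ → ℝ} (hg : MemLp g 2 (lawOf w)) :
      inner ℝ (v k) (hg.toLp g) = ∑' j, ψ k j * g j * w j := inner_toLp_lawOf hw (hmem k) hg
  have hsum := hasSum_inner_sq_div_of_orthogonal (v := v)
    (fun k hk => (hc k).ne (by rw [← hnormv, hk, norm_zero, zero_pow two_ne_zero]))
    (fun k l hkl => (hinner k (hmem l)).trans (horth hkl)) (fun x hx => ?_) (hf.toLp f)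
  · simpa only [hinner, hnormv, hnorm] using hsum
  · have hzero : w * x = 0 := by
      refine hcomplete x ((memLp_two_lawOf_iff hw _).1 (Lp.memLp x)) fun k => ?_
      rw [← hinner k (Lp.memLp x), Lp.toLp_coeFn, hx]
    refine inner_self_eq_zero.1 ((inner_lawOf hw x x).trans ?_)
    have (j : ℤ) : x j * x j * w j = 0 := by
      rw [mul_assoc, mul_comm _ (w j), show w j * x j = 0 from congrFun hzero j, mul_zero]
    simp only [this, tsum_zero]

end Law

namespace IsOrdSeq

variable {p q : ℤ → ℝ} {μ δ : ℝ} (H : IsOrdSeq p q μ δ)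

include H

theorem hasSum_parseval {ρ : ℝ} (hρ : 0 < ρ) (hexp : HasExpMoment p ρ) {i : ℕ} {h : ℤ → ℝ}
    (hh : Summable fun j => h j ^ 2 * wt p q i j) :
    HasSum (fun t : {t // ∃ j, 0 < wt p q (i + t) j} =>
      (∑' j, backDiff^[(t : ℕ)] (wt p q (i + t)) j * h j) ^ 2 /
        ((t : ℕ).factorial * leadCoef δ i t * momentA p q (i + t)))
      (∑' j, h j ^ 2 * wt p q i j) := by
  have hadm {t : ℕ} (ht : ∃ j, 0 < wt p q (i + t) j) : IsAdmissible p q (i + t) :=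
    ⟨hexp.hasMoment H.nonneg hρ _, ht⟩
  choose f hf hfw using fun t => H.exists_iterate_backDiff_wt t i
  have hpair {t : ℕ} (ht : ∃ j, 0 < wt p q (i + t) j) {d : ℝ} {g : ℤ → ℝ} (hg : HasLead t d g) :
      HasSum (fun j => f t j * g j * wt p q i j) (t.factorial * d * momentA p q (i + t)) := by
    refine (H.hasSum_iterate_backDiff_wt_mul (hadm ht).hasMoment hg).congr_fun fun j => ?_
    rw [hfw, mul_right_comm]
  have hcoef (t : ℕ) (g : ℤ → ℝ) : ∑' j, f t j * g j * wt p q i j =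
      ∑' j, backDiff^[t] (wt p q (i + t)) j * g j :=
    tsum_congr fun j => by rw [hfw, mul_right_comm]
  have horth {s t : ℕ} (ht : ∃ j, 0 < wt p q (i + t) j) (hst : s < t) :
      ∑' j, f t j * f s j * wt p q i j = 0 := by
    rw [(hpair ht ((hf s).of_lt hst)).tsum_eq, mul_zero, zero_mul]
  have hsum := hasSum_sq_div_of_orthogonal (H.wt_nonneg i)
    (ψ := fun t : {t // ∃ j, 0 < wt p q (i + t) j} => f t) (fun t => ?_)
    (fun t => (hpair t.2 (hf t)).congr_fun fun j => by rw [sq]) (fun s t hst => ?_)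
    (fun g hg hzero => H.mul_wt_eq_zero_of_orthogonal hρ hexp hg fun t ht => ?_) hh
  · simpa only [hcoef] using hsum
  · have := H.leadCoef_pos (hadm t.2)
    have := H.momentA_pos (hadm t.2)
    positivity
  · rcases lt_or_gt_of_ne (Subtype.coe_ne_coe.2 hst) with hlt | hlt
    · simpa only [mul_comm (f s _)] using horth t.2 hlt
    · exact horth s.2 hlt
  · rw [← hcoef]
    exact hzero ⟨t, ht⟩

end IsOrdSeq

/-! ### Cumulative Ord random variables -/

section PartialSums

variable {u : ℤ → ℝ}

theorem tsum_Iic_sub_tsum_Iic_pred (hu : Summable u) (j : ℤ) :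
    ∑' k : Set.Iic j, u k - ∑' k : Set.Iic (j - 1), u k = u j := by
  have hinsert : Set.Iic j = insert j (Set.Iic (j - 1)) := by
    ext k
    simp only [Set.mem_Iic, Set.mem_insert_iff]
    omega
  have hdisjoint : Disjoint {j} (Set.Iic (j - 1)) := by simp
  rw [hinsert, Set.insert_eq, (hu.subtype _).tsum_union_disjoint hdisjoint (hu.subtype _),
    tsum_singleton, add_sub_cancel_right]

theorem tendsto_tsum_Iic_atTop (hu : Summable u) :
    Tendsto (fun j : ℤ => ∑' k : Set.Iic j, u k) atTop (𝓝 (∑' k, u k)) := by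
  simp only [tsum_subtype]
  refine tendsto_tsum_of_dominated_convergence hu.norm (fun k => tendsto_const_nhds.congr' ?_)
    (.of_forall fun j k => norm_indicator_le_norm_self _ _)
  filter_upwards [eventually_ge_atTop k] with j hj
  exact (Set.indicator_of_mem (Set.mem_Iic.2 hj) u).symm

theorem tendsto_tsum_Iic_atBot (hu : Summable u) :
    Tendsto (fun j : ℤ => ∑' k : Set.Iic j, u k) atBot (𝓝 0) := by
  simp only [tsum_subtype]
  rw [← tsum_zero (β := ℤ)]
  refine tendsto_tsum_of_dominated_convergence hu.norm (fun k => tendsto_const_nhds.congr' ?_)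
    (.of_forall fun j k => norm_indicator_le_norm_self _ _)
  filter_upwards [eventually_lt_atBot k] with j hj
  exact (Set.indicator_of_notMem (Set.notMem_Iic.2 hj) u).symm

end PartialSums

theorem le_encard_sub_one_iff {S : Set ℤ} (hS : S.OrdConnected) (hne : S.Nonempty) {k : ℕ} :
    (k : ℕ∞) ≤ S.encard - 1 ↔ ∃ a ∈ S, a + k ∈ S := by
  have hcancel : AddLECancellable (1 : ℕ∞) := ENat.addLECancellable_of_ne_top ENat.one_ne_top
  rw [hcancel.le_tsub_iff_right (Set.one_le_encard_iff_nonempty.2 hne), ← Nat.cast_succ]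
  constructor
  · intro hk
    obtain ⟨T, hTS, hT⟩ := Set.exists_subset_encard_eq hk
    lift T to Finset ℤ using Set.finite_of_encard_eq_coe hT
    rw [Set.encard_coe_eq_coe_finsetCard, Nat.cast_inj] at hT
    have hTne : T.Nonempty := Finset.card_pos.1 (by omega)
    have hcard := Finset.card_le_card (t := Finset.Icc (T.min' hTne) (T.max' hTne)) fun x hx =>
      Finset.mem_Icc.2 ⟨T.min'_le x hx, T.le_max' x hx⟩
    rw [hT, Int.card_Icc] at hcard
    exact ⟨_, hTS (T.min'_mem hTne), hS.out (hTS (T.min'_mem hTne)) (hTS (T.max'_mem hTne))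
      ⟨by omega, by omega⟩⟩
  · rintro ⟨a, ha, hak⟩
    refine le_of_eq_of_le ?_ (Set.encard_le_encard (hS.out ha hak))
    rw [← Finset.coe_Icc, Set.encard_coe_eq_coe_finsetCard, Int.card_Icc]
    congr 1
    omega

section Pmf

variable {Ω : Type*} [MeasurableSpace Ω] {P : Measure Ω} {X : Ω → ℤ}

theorem pmfOf_nonneg (P : Measure Ω) (X : Ω → ℤ) (j : ℤ) : 0 ≤ pmfOf P X j := measureReal_nonneg

section Finite

variable [IsFiniteMeasure P] (hX : Measurable X)

include hX

theorem map_eq_lawOf_pmfOf : P.map X = lawOf (pmfOf P X) := by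
  refine Measure.ext_of_singleton fun j => ?_
  rw [lawOf_singleton, Measure.map_apply hX (measurableSet_singleton j), pmfOf, ofReal_measureReal]

theorem integrable_comp_iff (f : ℤ → ℝ) :
    Integrable (fun ω => f (X ω)) P ↔ Summable fun j => f j * pmfOf P X j := by
  rw [← integrable_lawOf_iff (pmfOf_nonneg P X), ← map_eq_lawOf_pmfOf hX,
    integrable_map_measure (measurable_of_countable _).aestronglyMeasurable hX.aemeasurable]
  rfl

theorem integral_comp_eq_tsum (f : ℤ → ℝ) : ∫ ω, f (X ω) ∂P = ∑' j, f j * pmfOf P X j := by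
  rw [← integral_lawOf (pmfOf_nonneg P X), ← map_eq_lawOf_pmfOf hX,
    integral_map hX.aemeasurable (measurable_of_countable _).aestronglyMeasurable]

theorem integrable_mul_comp_iff (f g : ℤ → ℝ) :
    Integrable (fun ω => f (X ω) * g (X ω)) P ↔ Summable fun j => f j * g j * pmfOf P X j :=
  integrable_comp_iff hX fun j => f j * g j

theorem integral_mul_comp_eq_tsum (f g : ℤ → ℝ) :
    ∫ ω, f (X ω) * g (X ω) ∂P = ∑' j, f j * g j * pmfOf P X j :=
  integral_comp_eq_tsum hX fun j => f j * g j

theorem integrable_ascPow_mul_sq_comp_iff (q f : ℤ → ℝ) (i : ℕ) :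
    Integrable (fun ω => ascPow q i (X ω) * f (X ω) ^ 2) P ↔
      Summable fun j => f j ^ 2 * wt (pmfOf P X) q i j := by
  rw [integrable_comp_iff hX fun j => ascPow q i j * f j ^ 2]
  simp only [wt, mul_assoc, mul_left_comm]

theorem integral_ascPow_mul_sq_comp_eq_tsum (q f : ℤ → ℝ) (i : ℕ) :
    ∫ ω, ascPow q i (X ω) * f (X ω) ^ 2 ∂P = ∑' j, f j ^ 2 * wt (pmfOf P X) q i j := by
  rw [integral_comp_eq_tsum hX fun j => ascPow q i j * f j ^ 2]
  simp only [wt, mul_assoc, mul_left_comm]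

theorem hasMoment_pmfOf {N : ℕ} (h : Integrable (fun ω => |(X ω : ℝ)| ^ N) P) :
    HasMoment (pmfOf P X) N := by
  have hbound : Integrable (fun ω => 2 ^ (N - 1) * (1 ^ N + |(X ω : ℝ)| ^ N)) P :=
    ((integrable_const _).add h).const_mul _
  refine (integrable_comp_iff hX fun j => (1 + |(j : ℝ)|) ^ N).1 (hbound.mono'
    ((measurable_of_countable fun j : ℤ => (1 + |(j : ℝ)|) ^ N).comp hX).aestronglyMeasurable
    (.of_forall fun ω => ?_))
  rw [Real.norm_of_nonneg (by positivity)]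
  exact add_pow_le zero_le_one (abs_nonneg _) N

end Finite

section Probability

variable [IsProbabilityMeasure P] (hX : Measurable X)

include hX

theorem hasSum_pmfOf : HasSum (pmfOf P X) 1 := by
  have hsum := ((integrable_comp_iff hX fun _ => 1).1 (integrable_const (μ := P) 1)).hasSum
  rw [← integral_comp_eq_tsum hX, integral_const, probReal_univ, one_smul] at hsum
  simpa only [one_mul] using hsum

theorem support_nonempty : (support P X).Nonempty := by
  by_contra h
  have hzero : pmfOf P X = 0 :=
    funext fun j => (not_lt.1 fun hj => h ⟨j, hj⟩).antisymm (pmfOf_nonneg P X j)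
  have hsum := hasSum_pmfOf (P := P) hX
  rw [hzero] at hsum
  exact one_ne_zero (hsum.unique hasSum_zero)

end Probability

end Pmf

namespace IsCO

variable {Ω : Type*} [MeasurableSpace Ω] {P : Measure Ω} [IsProbabilityMeasure P] {X : Ω → ℤ}
  {μ δ β γ : ℝ} (hX : IsCO P X μ δ β γ)

include hX

theorem hasSum_sub_mul_pmfOf : HasSum (fun j : ℤ => (μ - j) * pmfOf P X j) 0 := by
  have hmean := ((integrable_comp_iff hX.measurable fun j => (j : ℝ)).1 hX.integrable).hasSum
  rw [← integral_comp_eq_tsum hX.measurable, hX.mean_eq] at hmean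
  simpa only [mul_one, sub_self, sub_mul] using
    ((hasSum_pmfOf hX.measurable).mul_left μ).sub hmean

theorem isOrdSeq : IsOrdSeq (pmfOf P X) (quad δ β γ) μ δ where
  nonneg := pmfOf_nonneg P X
  hasLead := HasLead.quad δ β γ
  flux_sub j := by
    rw [← hX.cumulative, ← hX.cumulative]
    exact tsum_Iic_sub_tsum_Iic_pred hX.hasSum_sub_mul_pmfOf.summable j
  tendsto_atTop := by
    simp only [← hX.cumulative]
    rw [← hX.hasSum_sub_mul_pmfOf.tsum_eq]
    exact tendsto_tsum_Iic_atTop hX.hasSum_sub_mul_pmfOf.summable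
  tendsto_atBot := by
    simp only [← hX.cumulative]
    exact tendsto_tsum_Iic_atBot hX.hasSum_sub_mul_pmfOf.summable

theorem le_bigM_iff {k : ℕ} :
    (k : ℕ∞) ≤ bigM P X ↔ ∃ j, 0 < wt (pmfOf P X) (quad δ β γ) k j := by
  have hconn : (support P X).OrdConnected :=
    ⟨fun _ ha _ hb _ hj => hX.isOrdSeq.pos_of_le_of_le ha hb hj.1 hj.2⟩
  simp only [bigM, le_encard_sub_one_iff hconn (support_nonempty hX.measurable),
    hX.isOrdSeq.wt_pos_iff]
  rfl

theorem isAdmissible {k : ℕ} (hk : (k : ℕ∞) ≤ bigM P X)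
    (hmom : Integrable (fun ω => |(X ω : ℝ)| ^ (2 * k)) P) :
    IsAdmissible (pmfOf P X) (quad δ β γ) k :=
  ⟨hasMoment_pmfOf hX.measurable hmom, hX.le_bigM_iff.1 hk⟩

theorem isAdmissible_of_hasExpMoment {ρ : ℝ} (hρ : 0 < ρ) (hexp : HasExpMoment (pmfOf P X) ρ)
    {k : ℕ} (hk : (k : ℕ∞) ≤ bigM P X) : IsAdmissible (pmfOf P X) (quad δ β γ) k :=
  ⟨hexp.hasMoment (pmfOf_nonneg P X) hρ _, hX.le_bigM_iff.1 hk⟩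

theorem hasSum_weight_mul_sq {ρ : ℝ} (hρ : 0 < ρ) (hexp : HasExpMoment (pmfOf P X) ρ) {i : ℕ}
    {g : ℤ → ℝ}
    (hg : Summable fun j => diff i g j ^ 2 * wt (pmfOf P X) (quad δ β γ) i j) :
    HasSum
      (fun k : {k : ℕ // i ≤ k ∧ (k : ℕ∞) ≤ bigM P X} => weight δ k i *
        (∑' j, stdPoly (pmfOf P X) (quad δ β γ) δ k j * g j * pmfOf P X j) ^ 2)
      (∑' j, diff i g j ^ 2 * wt (pmfOf P X) (quad δ β γ) i j) := by
  let e : {t // ∃ j, 0 < wt (pmfOf P X) (quad δ β γ) (i + t) j} ≃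
      {k : ℕ // i ≤ k ∧ (k : ℕ∞) ≤ bigM P X} :=
    { toFun := fun t => ⟨i + t, i.le_add_right t, hX.le_bigM_iff.2 t.2⟩
      invFun := fun k => ⟨k - i, (Nat.add_sub_cancel' k.2.1).symm ▸ hX.le_bigM_iff.1 k.2.2⟩
      left_inv := fun t => Subtype.ext (Nat.add_sub_cancel_left i t)
      right_inv := fun k => Subtype.ext (Nat.add_sub_cancel' k.2.1) }
  refine e.hasSum_iff.1 ((hX.isOrdSeq.hasSum_parseval hρ hexp hg).congr_fun fun t => ?_)
  have ht : IsAdmissible (pmfOf P X) (quad δ β γ) (i + t) :=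
    hX.isAdmissible_of_hasExpMoment hρ hexp (e t).2.2
  have hcoef := (hX.isOrdSeq.hasSum_iterate_backDiff_mul_diff ht.hasMoment le_rfl
    (i.le_add_right t) hg).tsum_eq
  have hweight := hX.isOrdSeq.weight_mul_tsum_sq ht (i.le_add_right t) (i.le_add_right t) hg
  rw [Nat.add_sub_cancel_left] at hcoef hweight
  exact hweight.trans (by rw [hcoef])

end IsCO

theorem InClassC.exists_hasExpMoment {Ω : Type*} [MeasurableSpace Ω] {P : Measure Ω}
    [IsProbabilityMeasure P] {X : Ω → ℤ} (h : InClassC P X) :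
    ∃ ρ > 0, HasExpMoment (pmfOf P X) ρ := by
  obtain ⟨μ, δ, β, γ, hX, hδ | hfin⟩ := h
  · exact hX.isOrdSeq.exists_hasExpMoment hδ
  · refine ⟨1, one_pos, summable_of_hasFiniteSupport (hfin.subset fun j hj => ?_)⟩
    exact (pmfOf_nonneg P X j).lt_of_ne' (right_ne_zero_of_mul hj)

end CumOrd

end

open CumOrd in
theorem mainTheorem4_general {Ω : Type*} [MeasurableSpace Ω] (P : Measure Ω)
    [IsProbabilityMeasure P] (X : Ω → ℤ) (μ δ β γ : ℝ) (hX : IsCO P X μ δ β γ) (g : ℤ → ℝ)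
    (p q : ℤ → ℝ) (hp : p = pmfOf P X) (hq : q = quad δ β γ) :
    (∀ k : ℕ, (k : ℕ∞) ≤ bigM P X → Integrable (fun ω => |(X ω : ℝ)| ^ (2 * k)) P →
      (∀ i ≤ k, IsPmf (pmfI p q i)) ∧
      ∀ m ≤ k, MemLp (diff m g) 2 (lawOf (pmfI p q m)) →
        Integrable (fun ω => stdPoly p q δ k (X ω) * g (X ω)) P ∧
        ∀ i ≤ m,
          Integrable (fun j => stdPolyI p q δ (k - i) i j * diff i g j) (lawOf (pmfI p q i)) ∧
          ∫ j, stdPolyI p q δ (k - i) i j * diff i g j ∂(lawOf (pmfI p q i)) =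
            coeffV p q δ k i * ∫ ω, stdPoly p q δ k (X ω) * g (X ω) ∂P) ∧
    (InClassC P X → ∀ n : ℕ, (n : ℕ∞) ≤ bigM P X →
      MemLp (diff n g) 2 (lawOf (pmfI p q n)) →
        (∀ k : ℕ, (k : ℕ∞) ≤ bigM P X →
          Integrable (fun ω => stdPoly p q δ k (X ω) * g (X ω)) P) ∧
        ∀ i ≤ n,
          Integrable (fun ω => ascPow q i (X ω) * (diff i g (X ω)) ^ 2) P ∧
          HasSum
            (fun k : {k : ℕ // i ≤ k ∧ (k : ℕ∞) ≤ bigM P X} =>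
              weight δ k i * (∫ ω, stdPoly p q δ k (X ω) * g (X ω) ∂P) ^ 2)
            (∫ ω, ascPow q i (X ω) * (diff i g (X ω)) ^ 2 ∂P)) := by
  subst hp hq
  have H := hX.isOrdSeq
  have hXm := hX.measurable
  simp only [integrable_mul_comp_iff hXm, integral_mul_comp_eq_tsum hXm,
    integrable_ascPow_mul_sq_comp_iff hXm, integral_ascPow_mul_sq_comp_eq_tsum hXm,
    integrable_lawOf_iff (H.pmfI_nonneg _), integral_lawOf (H.pmfI_nonneg _)]
  refine ⟨fun k hkM hmom => ?_, fun hC n hnM hg => ?_⟩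
  · have hk := hX.isAdmissible hkM hmom
    refine ⟨fun i hi => H.isPmf_pmfI (H.isAdmissible_of_le hk hi), fun m hmk hg => ?_⟩
    have hg := (H.memLp_two_lawOf_pmfI_iff (H.isAdmissible_of_le hk hmk) _).1 hg
    exact ⟨(H.hasSum_stdPoly_mul hk hmk hg).summable, fun i hi =>
      have hsum := H.hasSum_stdPolyI_mul_diff hk hi hmk hg
      ⟨hsum.summable, hsum.tsum_eq⟩⟩
  · obtain ⟨ρ, hρ, hexp⟩ := hC.exists_hasExpMoment
    have hn := hX.isAdmissible_of_hasExpMoment hρ hexp hnM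
    have hg (i : ℕ) :=
      H.summable_diff_sq_mul_wt hn ((H.memLp_two_lawOf_pmfI_iff hn _).1 hg) (i := i)
    refine ⟨fun k hk => ?_, fun i hi => ⟨hg i hi, hX.hasSum_weight_mul_sq hρ hexp (hg i hi)⟩⟩
    have hk := hX.isAdmissible_of_hasExpMoment hρ hexp hk
    exact (H.hasSum_stdPoly_mul hk k.zero_le (hg 0 n.zero_le)).summable

theorem mainTheorem4 {Ω : Type*} [MeasurableSpace Ω] (P : Measure Ω) [IsProbabilityMeasure P]
    (X : Ω → ℤ) (μ δ β γ : ℝ) (hX : CumOrd.IsCO P X μ δ β γ) (g : ℤ → ℝ)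
    (p q : ℤ → ℝ) (hp : p = CumOrd.pmfOf P X) (hq : q = CumOrd.quad δ β γ) :
    (∀ k : ℕ, 1 ≤ k → (k : ℕ∞) ≤ CumOrd.bigM P X →
      Integrable (fun ω => |(X ω : ℝ)| ^ (2 * k + 1)) P →
      (∀ i ≤ k, CumOrd.IsPmf (CumOrd.pmfI p q i)) ∧
      ∀ m ≤ k, MemLp (CumOrd.diff m g) 2 (CumOrd.lawOf (CumOrd.pmfI p q m)) →
        Integrable (fun ω => CumOrd.stdPoly p q δ k (X ω) * g (X ω)) P ∧
        ∀ i ≤ m,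
          Integrable (fun j => CumOrd.stdPolyI p q δ (k - i) i j * CumOrd.diff i g j)
            (CumOrd.lawOf (CumOrd.pmfI p q i)) ∧
          ∫ j, CumOrd.stdPolyI p q δ (k - i) i j * CumOrd.diff i g j
              ∂(CumOrd.lawOf (CumOrd.pmfI p q i)) =
            CumOrd.coeffV p q δ k i * ∫ ω, CumOrd.stdPoly p q δ k (X ω) * g (X ω) ∂P) ∧
    (CumOrd.InClassC P X →
      ∀ n : ℕ, 1 ≤ n → (n : ℕ∞) ≤ CumOrd.bigM P X →
        MemLp (CumOrd.diff n g) 2 (CumOrd.lawOf (CumOrd.pmfI p q n)) →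
        (∀ k : ℕ, (k : ℕ∞) ≤ CumOrd.bigM P X →
          Integrable (fun ω => CumOrd.stdPoly p q δ k (X ω) * g (X ω)) P) ∧
        ∀ i ≤ n,
          Integrable (fun ω => CumOrd.ascPow q i (X ω) * (CumOrd.diff i g (X ω)) ^ 2) P ∧
          HasSum
            (fun k : {k : ℕ // i ≤ k ∧ (k : ℕ∞) ≤ CumOrd.bigM P X} =>
              CumOrd.weight δ k i *
                (∫ ω, CumOrd.stdPoly p q δ k (X ω) * g (X ω) ∂P) ^ 2)
            (∫ ω, CumOrd.ascPow q i (X ω) * (CumOrd.diff i g (X ω)) ^ 2 ∂P)) := by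
  obtain ⟨ha, hb⟩ := mainTheorem4_general P X μ δ β γ hX g p q hp hq
  exact ⟨fun k _ hk hmom => ha k hk
    (integrable_norm_pow_of_le hX.integrable.aestronglyMeasurable (2 * k).le_succ hmom),
    fun hC n _ => hb hC n⟩
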